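/- For a finite sequence $s=(s_1,\dots,s_r)$ of positive integers ($r\ge 0$) with $s_1\ge 2$ if $r\ge1$, let $$\mathcal{H}e^{s_1,\dots,s_r}(z)=\sum_{0<n_r<\cdots<n_1}\frac{1}{(n_1+z)^{s_1}\cdots(n_r+z)^{s_r}},\qquad z\in\mathbb{C}\setminus(-\mathbb{N}),\ \mathbb{N}=\{0,1,2,\dots\},$$ be the Hurwitz multizeta function ($\mathcal{H}e^{\emptyset}=1$), and let $\mathcal{H}mzf_{cv}$ be the $\mathbb{Q}$-algebra of functions on $\mathbb{C}\setminus(-\mathbb{N})$ generated by all of them. Let $QSym$ be the $\mathbb{Q}$-algebra of quasi-symmetric functions (power series of bounded degree in $x_1,x_2,\dots$ in which the coefficients of $x_{i_1}^{a_1}\cdots x_{i_r}^{a_r}$ and $x_{j_1}^{a_1}\cdots x_{j_r}^{a_r}$ agree whenever $i_1<\cdots<i_r$ and $j_1<\cdots<j_r$), let $M_{I}=\sum_{n_1>\cdots>n_r>0}x_{n_1}^{i_1}\cdots x_{n_r}^{i_r}$ for a composition $I=(i_1,\dots,i_r)$ ($M_\emptyset=1$), and let $QSym_{cv}$ be the subalgebra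 of $QSym$ generated by the $M_I$ with $I=\emptyset$ or $i_1\ge2$. Then $\mathcal{H}mzf_{cv}$ and $QSym_{cv}$ are the $\mathbb{Q}$-linear spans of these generating families, and $$\mathcal{H}mzf_{cv}\simeq QSym_{cv}\simeq \mathbb{Q}\big[\mathcal{L}yn(y_1;y_2;\dots)\setminus\{y_1\}\big]$$ as $\mathbb{Q}$-algebras, where the right-hand side is the polynomial algebra whose indeterminates are the Lyndon words, other than the one-letter word $y_1$, over the alphabet $\{y_1,y_2,\dots\}$. More precisely, the first isomorphism can be chosen to exchange $\mathcal{H}e^{I}$ and $M_I$ for every $I$. The second holds whichever total order on the letters is used to define Lyndon words, and for the order $y_1>y_2>\cdots$ it can be chosen to match each Lyndon word $y_{i_1}\cdots y_{i_r}\neq y_1$ with $M_{i_1,\dots,i_r}$. In particular $\mathcal{H}mzf_{cv}$ is a polynomial algebra over $\mathbb{Q}$. -/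

import Mathlib

/-! Words over the alphabet `Y = {y₁, y₂, …}`, compositions and index sequences `(s₁, …, s_r)`
are all lists of positive integers, the letter `y_i` being `i`. -/

/-- Lyndon words for the strict total order `lt` on the alphabet: nonempty words which are
lexicographically smaller than each of their proper nonempty suffixes. -/
def IsLyndon (lt : ℕ+ → ℕ+ → Prop) (w : List ℕ+) : Prop :=
  w ≠ [] ∧ ∀ u v : List ℕ+, u ≠ [] → v ≠ [] → w = u ++ v → List.Lex lt w v

/-- The Lyndon words, for the order `lt` on `{y₁, y₂, …}`, other than the one-letter word `y₁`. -/
abbrev LyndonWordNeOne (lt : ℕ+ → ℕ+ → Prop) : Type :=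
  {w : List ℕ+ // IsLyndon lt w ∧ w ≠ [1]}

/-- The sequences `(s₁, …, s_r)`, `r ≥ 0`, of positive integers with `s₁ ≥ 2`; the condition is
empty for `r = 0`. -/
abbrev ConvIndex : Type :=
  {s : List ℕ+ // ∀ a ∈ s.head?, 2 ≤ a}

/-- The domain `ℂ - (-ℕ)`. -/
abbrev HurwitzDomain : Type :=
  {z : ℂ // ∀ n : ℕ, z ≠ -(n : ℂ)}

/-- The series `∑_{0 < n_r < ⋯ < n_1} 1 / ((n_1 + z)^{s_1} ⋯ (n_r + z)^{s_r})`. -/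
noncomputable def hurwitzMultizeta (s : List ℕ+) (z : HurwitzDomain) : ℂ :=
  ∑' n : {n : Fin s.length → ℕ+ // StrictAnti n},
    ∏ k : Fin s.length, 1 / (((n.1 k : ℕ) : ℂ) + z.1) ^ (s.get k : ℕ)

/-- The `ℚ`-algebra, for pointwise operations, generated by the Hurwitz multizeta functions with
`s₁ ≥ 2` (the constant function `1` included, as the one of the empty sequence). -/
noncomputable def HmzfCv : Subalgebra ℚ (HurwitzDomain → ℂ) :=
  Algebra.adjoin ℚ (Set.range fun s : ConvIndex => hurwitzMultizeta s.1)

/-- Equality of the coefficients of `x_{i_1}^{a_1} ⋯ x_{i_r}^{a_r}` and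
`x_{j_1}^{a_1} ⋯ x_{j_r}^{a_r}` whenever `i_1 < ⋯ < i_r` and `j_1 < ⋯ < j_r`. (Exponents equal
to zero may be left out, so allowing them changes nothing.) -/
def IsQuasiSymmetric (f : MvPowerSeries ℕ+ ℚ) : Prop :=
  ∀ (r : ℕ) (a : Fin r →₀ ℕ) (i j : Fin r → ℕ+), StrictMono i → StrictMono j →
    MvPowerSeries.coeff (a.mapDomain i) f = MvPowerSeries.coeff (a.mapDomain j) f

/-- A power series of bounded degree. -/
def HasBoundedDegree (f : MvPowerSeries ℕ+ ℚ) : Prop :=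
  ∃ d : ℕ, ∀ e : ℕ+ →₀ ℕ, d < e.degree → MvPowerSeries.coeff e f = 0

theorem coeff_mapDomain_mul {r : ℕ} (a : Fin r →₀ ℕ) (i : Fin r → ℕ+)
    (hi : Function.Injective i) (f g : MvPowerSeries ℕ+ ℚ) :
    MvPowerSeries.coeff (a.mapDomain i) (f * g) =
      ∑ p ∈ Finset.HasAntidiagonal.antidiagonal a, MvPowerSeries.coeff (p.1.mapDomain i) f *
        MvPowerSeries.coeff (p.2.mapDomain i) g := by
  classical
  rw [MvPowerSeries.coeff_mul]
  symm
  refine Finset.sum_bij (fun p _ => (p.1.mapDomain i, p.2.mapDomain i)) ?_ ?_ ?_ ?_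
  · intro p hp
    rw [Finset.HasAntidiagonal.mem_antidiagonal] at hp ⊢
    rw [← hp, Finsupp.mapDomain_add]
  · intro p _ q _ h
    simp only [Prod.mk.injEq] at h
    exact Prod.ext (Finsupp.mapDomain_injective hi h.1) (Finsupp.mapDomain_injective hi h.2)
  · intro q hq
    rw [Finset.HasAntidiagonal.mem_antidiagonal] at hq
    have key : ∀ b : ℕ+ →₀ ℕ, b ≤ a.mapDomain i →
        (b.comapDomain i hi.injOn).mapDomain i = b := by
      intro b hb
      refine Finsupp.mapDomain_comapDomain i hi b ?_
      intro x hx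
      by_contra hx'
      have h0 := hb x
      rw [Finsupp.mapDomain_of_notMem_range _ _ hx'] at h0
      exact (Finsupp.mem_support_iff.mp hx) (Nat.le_zero.mp h0)
    have h1 := key q.1 (by rw [← hq]; exact le_self_add)
    have h2 := key q.2 (by rw [← hq]; exact le_add_self)
    refine ⟨(q.1.comapDomain i hi.injOn, q.2.comapDomain i hi.injOn), ?_, ?_⟩
    · rw [Finset.HasAntidiagonal.mem_antidiagonal]
      apply Finsupp.mapDomain_injective hi
      rw [Finsupp.mapDomain_add]
      simp only [h1, h2, hq]
    · simp only [h1, h2]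
  · intro p _
    rfl

theorem coeff_algebraMap_mapDomain {r : ℕ} (a : Fin r →₀ ℕ) (i : Fin r → ℕ+)
    (hi : Function.Injective i) (c : ℚ) :
    MvPowerSeries.coeff (a.mapDomain i) (algebraMap ℚ (MvPowerSeries ℕ+ ℚ) c) =
      if a = 0 then c else 0 := by
  classical
  rw [MvPowerSeries.algebraMap_apply, MvPowerSeries.coeff_C]
  have : a.mapDomain i = 0 ↔ a = 0 :=
    ⟨fun h => Finsupp.mapDomain_injective hi (by rw [h, Finsupp.mapDomain_zero]),
      fun h => by rw [h, Finsupp.mapDomain_zero]⟩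
  simp [this]

/-- The `ℚ`-algebra of quasi-symmetric functions in `x₁, x₂, …`. -/
def QSym : Subalgebra ℚ (MvPowerSeries ℕ+ ℚ) where
  carrier := {f | IsQuasiSymmetric f ∧ HasBoundedDegree f}
  mul_mem' := by
    rintro f g ⟨hf, df, hdf⟩ ⟨hg, dg, hdg⟩
    refine ⟨?_, df + dg, ?_⟩
    · intro r a i j hi hj
      rw [coeff_mapDomain_mul a i hi.injective, coeff_mapDomain_mul a j hj.injective]
      refine Finset.sum_congr rfl fun p _ => ?_
      rw [hf r p.1 i j hi hj, hg r p.2 i j hi hj]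
    · intro e he
      classical
      rw [MvPowerSeries.coeff_mul]
      refine Finset.sum_eq_zero fun p hp => ?_
      rw [Finset.HasAntidiagonal.mem_antidiagonal] at hp
      rw [← hp, map_add] at he
      by_cases h : df < p.1.degree
      · rw [hdf _ h, zero_mul]
      · rw [hdg p.2 (by omega), mul_zero]
  add_mem' := by
    rintro f g ⟨hf, df, hdf⟩ ⟨hg, dg, hdg⟩
    refine ⟨?_, max df dg, ?_⟩
    · intro r a i j hi hj
      rw [map_add, map_add, hf r a i j hi hj, hg r a i j hi hj]
    · intro e he
      rw [map_add, hdf e (lt_of_le_of_lt (le_max_left _ _) he),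
        hdg e (lt_of_le_of_lt (le_max_right _ _) he), add_zero]
  algebraMap_mem' := by
    intro c
    refine ⟨?_, 0, ?_⟩
    · intro r a i j hi hj
      rw [coeff_algebraMap_mapDomain a i hi.injective, coeff_algebraMap_mapDomain a j hj.injective]
    · intro e he
      classical
      rw [MvPowerSeries.algebraMap_apply, MvPowerSeries.coeff_C, if_neg]
      · rintro rfl
        simp at he

open Classical in
/-- The power series `M_I = ∑_{n_1 > ⋯ > n_r > 0} x_{n_1}^{i_1} ⋯ x_{n_r}^{i_r}` for
`I = (i_1, …, i_r)`; as the parts are positive, no monomial occurs twice in this sum. -/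
noncomputable def monomialSeries (I : List ℕ+) : MvPowerSeries ℕ+ ℚ := fun e =>
  if ∃ n : Fin I.length → ℕ+, StrictAnti n ∧
    e = ∑ k : Fin I.length, Finsupp.single (n k) (I.get k : ℕ) then 1 else 0

theorem monomialSeries_transfer (I : List ℕ+) {r : ℕ} (a : Fin r →₀ ℕ) (i j : Fin r → ℕ+)
    (hi : StrictMono i) (hj : StrictMono j)
    (h : ∃ n : Fin I.length → ℕ+, StrictAnti n ∧
      a.mapDomain i = ∑ k : Fin I.length, Finsupp.single (n k) (I.get k : ℕ)) :
    ∃ n : Fin I.length → ℕ+, StrictAnti n ∧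
      a.mapDomain j = ∑ k : Fin I.length, Finsupp.single (n k) (I.get k : ℕ) := by
  obtain ⟨n, hn, hsum⟩ := h
  have hrange : ∀ k, ∃ l, i l = n k := by
    intro k
    by_contra hk
    have h0 := Finsupp.mapDomain_of_notMem_range a (n k) (f := i) hk
    rw [hsum, Finsupp.finsetSum_apply] at h0
    have h1 := (Finset.sum_eq_zero_iff.mp h0) k (Finset.mem_univ k)
    rw [Finsupp.single_eq_same] at h1
    exact (I.get k).ne_zero h1
  choose σ hσ using hrange
  have hσanti : StrictAnti σ := by
    intro k l hkl
    rw [← hi.lt_iff_lt, hσ, hσ]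
    exact hn hkl
  have ha : a = ∑ k : Fin I.length, Finsupp.single (σ k) (I.get k : ℕ) := by
    apply Finsupp.mapDomain_injective hi.injective
    rw [hsum, Finsupp.mapDomain_finsetSum]
    refine Finset.sum_congr rfl fun k _ => ?_
    rw [Finsupp.mapDomain_single, hσ]
  refine ⟨fun k => j (σ k), fun k l hkl => hj (hσanti hkl), ?_⟩
  conv_lhs => rw [ha]
  rw [Finsupp.mapDomain_finsetSum]
  exact Finset.sum_congr rfl fun k _ => Finsupp.mapDomain_single

theorem monomialSeries_mem (I : List ℕ+) : monomialSeries I ∈ QSym := by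
  classical
  refine ⟨?_, ∑ k : Fin I.length, (I.get k : ℕ), ?_⟩
  · intro r a i j hi hj
    change (if _ then (1 : ℚ) else 0) = (if _ then (1 : ℚ) else 0)
    refine if_congr ⟨fun h => ?_, fun h => ?_⟩ rfl rfl
    · exact monomialSeries_transfer I a i j hi hj h
    · exact monomialSeries_transfer I a j i hj hi h
  · intro e he
    change (if _ then (1 : ℚ) else 0) = 0
    rw [if_neg]
    rintro ⟨n, -, rfl⟩
    rw [map_sum] at he
    simp at he

/-- The monomial quasi-symmetric function `M_I`. -/
noncomputable def monomialQSym (I : List ℕ+) : QSym :=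
  ⟨monomialSeries I, monomialSeries_mem I⟩

/-- The subalgebra of `QSym` generated by the `M_I` with `i₁ ≥ 2` (and `M_∅ = 1`). -/
noncomputable def QSymCv : Subalgebra ℚ QSym :=
  Algebra.adjoin ℚ (Set.range fun I : ConvIndex => monomialQSym I.1)

/-- `M_I`, for `i₁ ≥ 2`, as an element of `QSymCv`. -/
noncomputable def monomialQSymCv (I : ConvIndex) : QSymCv :=
  ⟨monomialQSym I.1, Algebra.subset_adjoin ⟨I, rfl⟩⟩

/-! The first isomorphism rests on both families obeying the same product rule, the quasi-shuffle of
words. For sums truncated at `N ≥ n₁ > ⋯ > n_r > 0` this is a finite identity (`truncSum_mul`).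
Coefficientwise stabilisation carries it to the `M_I`, and absolute convergence to the Hurwitz
series. Quasi-shuffles of convergent words are convergent, so the linear spans are already algebras.
Each `M_I` owns a monomial, hence the `M_I` are independent. What remains is the linear independence
of the `He^s`.

That independence is proved with polynomial coefficients (`eq_zero_of_eventually_sum_eq_zero`).
Splitting off the smallest index gives `He^{ua}(z-1) = He^{ua}(z) + z⁻ᵃ He^u(z)`. Let `F = ∑ p_s
He^s` vanish, let `s₀ = ta` have maximal length among the words that occur, and let `q = p_{s₀}`. In
`q(z) F(z-1) - q(z-1) F(z)` the word `s₀` disappears and no new word of that length appears, so by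
induction all coefficients vanish. For the words of maximal length this makes `p_s / q` periodic,
hence a constant `c_s`. For `t` it makes `∑ c_{tb} z⁻ᵇ`, a nonzero sum, equal to `R(z) - R(z-1)` up
to sign with `R = p_t / q`. This is impossible: the poles of `R` would propagate without end along
`z + ℤ` (`X_pow_mul_telescope_ne_zero`).

For the second isomorphism take `y₁ > y₂ > ⋯` and compare words by length, then lexicographically.
The leading word in a product of `M_l`, over Lyndon words `l` in decreasing order, is their
concatenation (`le_flatten_of_mem_stuffleProd`). Since `y₁` is the top letter, a word is convergent
exactly when `y₁` is not among its Lyndon factors. By existence and uniqueness of the Lyndon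
factorization, the monomials in the `M_l` are therefore triangular with respect to the basis of the
convergent `M_I`. The weight is preserved and its levels are finite, so these monomials form a basis
too. Any other order yields equally many indeterminates. -/

/-! ### Quasi-shuffle product and truncated nested sums -/

/-- The words of the quasi-shuffle product of two words, with multiplicity. -/
def stuffle {α : Type*} [Add α] : List α → List α → Multiset (List α)
  | [], v => {v}
  | a :: u, [] => {a :: u}
  | a :: u, b :: v =>
    (stuffle u (b :: v)).map (List.cons a) + (stuffle (a :: u) v).map (List.cons b) +
      (stuffle u v).map (List.cons (a + b))
termination_by u v => u.length + v.length

/-- The sum of `f n₁ s₁ ⋯ f n_r s_r` over `N ≥ n₁ > ⋯ > n_r > 0`. -/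
def truncSum {R : Type*} [CommRing R] (f : ℕ → ℕ+ → R) : ℕ → List ℕ+ → R
  | _, [] => 1
  | 0, _ :: _ => 0
  | N + 1, a :: u => truncSum f N (a :: u) + f (N + 1) a * truncSum f N u

section truncSum

variable {R : Type*} [CommRing R] (f : ℕ → ℕ+ → R)

@[simp] theorem truncSum_nil (N : ℕ) : truncSum f N [] = 1 := by
  cases N <;> rfl

@[simp] theorem truncSum_zero_cons (a : ℕ+) (u : List ℕ+) : truncSum f 0 (a :: u) = 0 := rfl

theorem truncSum_succ_cons (N : ℕ) (a : ℕ+) (u : List ℕ+) :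
    truncSum f (N + 1) (a :: u) = truncSum f N (a :: u) + f (N + 1) a * truncSum f N u := rfl

theorem sum_map_truncSum_succ_cons (N : ℕ) (a : ℕ+) (s : Multiset (List ℕ+)) :
    ((s.map (List.cons a)).map (truncSum f (N + 1))).sum =
      ((s.map (List.cons a)).map (truncSum f N)).sum +
        f (N + 1) a * (s.map (truncSum f N)).sum := by
  simp only [Multiset.map_map, Function.comp_def, truncSum_succ_cons, Multiset.sum_map_add,
    Multiset.sum_map_mul_left]

/-- Induction on the bound, splitting each factor by whether its largest index is `N + 1`. If
neither is, the induction hypothesis for the same words applies. The three other cases are the three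
branches of the quasi-shuffle, with `hf` merging two letters that sit at the same index. -/
theorem truncSum_mul (hf : ∀ n a b, f n a * f n b = f n (a + b)) (N : ℕ) (u v : List ℕ+) :
    truncSum f N u * truncSum f N v = ((stuffle u v).map (truncSum f N)).sum := by
  induction N generalizing u v with
  | zero =>
    rcases u with - | ⟨a, u⟩
    · simp [stuffle]
    rcases v with - | ⟨b, v⟩
    · simp [stuffle]
    · simp [stuffle, Multiset.map_map, Function.comp_def]
  | succ N ih =>
    rcases u with - | ⟨a, u⟩
    · simp [stuffle]
    rcases v with - | ⟨b, v⟩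
    · simp [stuffle]
    have h := ih (a :: u) (b :: v)
    rw [stuffle] at h ⊢
    simp only [Multiset.map_add, Multiset.sum_add] at h ⊢
    simp only [sum_map_truncSum_succ_cons, ← ih]
    rw [truncSum_succ_cons, truncSum_succ_cons, ← hf]
    linear_combination h

/-- The defining recursion splits off the largest index. Here the smallest possible index, `1`, is
split off instead, and the others are shifted. In the limit this is the difference equation of the
Hurwitz multizeta functions. -/
theorem truncSum_succ_concat (N : ℕ) (u : List ℕ+) (a : ℕ+) :
    truncSum f (N + 1) (u ++ [a]) = truncSum (fun n => f (n + 1)) N (u ++ [a]) +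
      f 1 a * truncSum (fun n => f (n + 1)) N u := by
  induction N generalizing u with
  | zero =>
    rcases u with - | ⟨b, u⟩
    · simp [truncSum_succ_cons]
    · rcases u with - | ⟨c, u⟩ <;> simp [truncSum_succ_cons]
  | succ N ih =>
    rcases u with - | ⟨b, u⟩
    · have := ih []
      simp only [List.nil_append, truncSum_nil] at this
      rw [List.nil_append, truncSum_succ_cons, this, truncSum_succ_cons]
      simp only [truncSum_nil]
      ring
    · rw [List.cons_append, truncSum_succ_cons, ih u, ← List.cons_append, ih (b :: u),
        List.cons_append, truncSum_succ_cons, truncSum_succ_cons]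
      ring

end truncSum

/-- The maps `Fin r → ℕ+` with values at most `N`. -/
def boundedMaps (r N : ℕ) : Finset (Fin r → ℕ+) :=
  Fintype.piFinset fun _ => (Finset.range N).map ⟨Nat.succPNat, Nat.succPNat_injective⟩

theorem mem_boundedMaps {r N : ℕ} {n : Fin r → ℕ+} :
    n ∈ boundedMaps r N ↔ ∀ k, (n k : ℕ) ≤ N := by
  simp only [boundedMaps, Fintype.mem_piFinset, Finset.mem_map, Finset.mem_range,
    Function.Embedding.coeFn_mk]
  refine forall_congr' fun k => ⟨?_, fun h => ⟨(n k).natPred, ?_, PNat.succPNat_natPred _⟩⟩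
  · rintro ⟨m, hm, h⟩
    rw [← h]
    simpa using hm
  · have := PNat.natPred_add_one (n k)
    omega

theorem strictAnti_cons_iff {r : ℕ} {m : ℕ+} {n : Fin r → ℕ+} :
    StrictAnti (Fin.cons m n : Fin (r + 1) → ℕ+) ↔ (∀ k, n k < m) ∧ StrictAnti n := by
  constructor
  · intro h
    exact ⟨fun k => by simpa using h (Fin.succ_pos k),
      fun i j hij => by simpa using h (Fin.succ_lt_succ_iff.mpr hij)⟩
  · rintro ⟨h1, h2⟩ i j hij
    induction j using Fin.cases with
    | zero => exact absurd hij (Fin.not_lt_zero i)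
    | succ j =>
      induction i using Fin.cases with
      | zero => simpa using h1 j
      | succ i => simpa using h2 (Fin.succ_lt_succ_iff.mp hij)

open Classical in
theorem filter_strictAnti_boundedMaps_zero (N : ℕ) :
    (boundedMaps 0 N).filter StrictAnti = {Fin.elim0} := by
  ext n
  simp [mem_boundedMaps, StrictAnti, Subsingleton.elim n Fin.elim0]

-- The recursion corresponds to splitting strictly decreasing maps bounded by `N + 1` according to
-- whether their first value is at most `N` or equal to `N + 1`.
open Classical in
theorem truncSum_eq_sum {R : Type*} [CommRing R] (f : ℕ → ℕ+ → R) (N : ℕ) (s : List ℕ+) :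
    truncSum f N s = ∑ n ∈ (boundedMaps s.length N).filter StrictAnti,
      ∏ k : Fin s.length, f (n k) (s.get k) := by
  induction N generalizing s with
  | zero =>
    rcases s with - | ⟨a, u⟩
    · simp [filter_strictAnti_boundedMaps_zero]
    · rw [truncSum_zero_cons, Finset.filter_eq_empty_iff.mpr, Finset.sum_empty]
      intro n hn
      have := mem_boundedMaps.mp hn ⟨0, by simp⟩
      exact absurd this (by simp)
  | succ N ih =>
    rcases s with - | ⟨a, u⟩
    · simp [filter_strictAnti_boundedMaps_zero]
    rw [truncSum_succ_cons, ih, ih u, Finset.mul_sum]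
    have hset : (boundedMaps (a :: u).length (N + 1)).filter StrictAnti =
        (boundedMaps (a :: u).length N).filter StrictAnti ∪
          ((boundedMaps u.length N).filter StrictAnti).image
            (fun n => (Fin.cons N.succPNat n : Fin (u.length + 1) → ℕ+)) := by
      ext n
      simp only [Finset.mem_union, Finset.mem_filter, Finset.mem_image, mem_boundedMaps]
      constructor
      · rintro ⟨h1, h2⟩
        by_cases h : (n ⟨0, by simp⟩ : ℕ) ≤ N
        · left
          refine ⟨fun k => le_trans ?_ h, h2⟩
          exact_mod_cast h2.antitone (Fin.mk_le_of_le_val (Nat.zero_le _))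
        · right
          have h0 : n ⟨0, by simp⟩ = N.succPNat := by
            apply PNat.coe_injective
            have := h1 ⟨0, by simp⟩
            simp only [Nat.succPNat_coe]
            omega
          have hc : (Fin.cons N.succPNat (fun k => n (Fin.succ k)) : Fin (u.length + 1) → ℕ+) =
              n := by
            rw [← h0]
            exact Fin.cons_self_tail n
          rw [← hc] at h2
          obtain ⟨h3, h4⟩ := strictAnti_cons_iff.mp h2
          refine ⟨fun k => n (Fin.succ k), ⟨fun k => ?_, h4⟩, hc⟩
          have := PNat.coe_lt_coe _ _ |>.mpr (h3 k)
          simp only [Nat.succPNat_coe] at this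
          exact Nat.lt_succ_iff.mp this
      · rintro (⟨h1, h2⟩ | ⟨m, ⟨h1, h2⟩, rfl⟩)
        · exact ⟨fun k => (h1 k).trans (Nat.le_succ _), h2⟩
        · refine ⟨fun k => ?_, strictAnti_cons_iff.mpr ⟨fun k => ?_, h2⟩⟩
          · revert k
            refine Fin.cases ?_ fun k => ?_
            · simp
            · simpa using (h1 k).trans (Nat.le_succ _)
          · rw [← PNat.coe_lt_coe]
            simpa using Nat.lt_succ_of_le (h1 k)
    rw [hset, Finset.sum_union, Finset.sum_image]
    · congr 1
      refine Finset.sum_congr rfl fun n _ => ?_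
      change _ = ∏ k : Fin (u.length + 1), _
      rw [Fin.prod_univ_succ]
      simp
    · intro m _ n _ h
      exact (Fin.cons_injective2 h).2
    · rw [Finset.disjoint_left]
      intro n hn hn'
      obtain ⟨m, -, rfl⟩ := Finset.mem_image.mp hn'
      have := mem_boundedMaps.mp (Finset.mem_filter.mp hn).1 ⟨0, by simp⟩
      change ((Fin.cons N.succPNat m : Fin (u.length + 1) → ℕ+) 0 : ℕ) ≤ N at this
      simp at this

/-- The support of the monomial is the range of `n`, a finite set has only one decreasing
enumeration, and the exponents are then read off. So a monomial determines its index sequence and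
its composition. -/
theorem strictAnti_eq_of_sum_single_eq {r r' : ℕ} {n : Fin r → ℕ+} {n' : Fin r' → ℕ+}
    (hn : StrictAnti n) (hn' : StrictAnti n') {a : Fin r → ℕ+} {a' : Fin r' → ℕ+}
    (h : ∑ k, Finsupp.single (n k) (a k : ℕ) = ∑ k, Finsupp.single (n' k) (a' k : ℕ)) :
    List.ofFn n = List.ofFn n' ∧ List.ofFn a = List.ofFn a' := by
  classical
  have happ : ∀ {r : ℕ} {n : Fin r → ℕ+} (_ : StrictAnti n) (a : Fin r → ℕ+) (k : Fin r),
      (∑ k, Finsupp.single (n k) (a k : ℕ)) (n k) = a k := by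
    intro r n hn a k
    rw [Finsupp.finsetSum_apply, Finset.sum_eq_single k]
    · simp
    · intro l _ hl
      rw [Finsupp.single_eq_of_ne]
      exact fun h => hl (hn.injective h).symm
    · simp
  have hsupp : ∀ {r : ℕ} {n : Fin r → ℕ+} (_ : StrictAnti n) (a : Fin r → ℕ+),
      ((∑ k, Finsupp.single (n k) (a k : ℕ)).support : Set ℕ+) = Set.range n := by
    intro r n hn a
    ext m
    simp only [Finset.mem_coe, Finsupp.mem_support_iff, Set.mem_range]
    constructor
    · intro hm
      by_contra hne
      apply hm
      rw [Finsupp.finsetSum_apply]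
      refine Finset.sum_eq_zero fun k _ => ?_
      rw [Finsupp.single_eq_of_ne]
      exact fun h => hne ⟨k, h.symm⟩
    · rintro ⟨k, rfl⟩
      rw [happ hn]
      exact (a k).ne_zero
  have hr : Set.range n = Set.range n' := by rw [← hsupp hn a, ← hsupp hn' a', h]
  have hcard : r = r' := by
    have := congrArg Set.ncard hr
    rwa [← Set.image_univ, ← Set.image_univ, Set.ncard_image_of_injective _ hn.injective,
      Set.ncard_image_of_injective _ hn'.injective, Set.ncard_univ, Set.ncard_univ, Nat.card_fin,
      Nat.card_fin] at this
  subst hcard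
  have hnn : n = n' := by
    have h1 : StrictMono (OrderDual.toDual ∘ n) := hn.dual_right
    have h2 : StrictMono (OrderDual.toDual ∘ n') := hn'.dual_right
    have h3 : Set.range (OrderDual.toDual ∘ n) = Set.range (OrderDual.toDual ∘ n') := hr
    exact (StrictMono.range_inj h1 h2).mp h3
  subst hnn
  refine ⟨rfl, congrArg _ ?_⟩
  funext k
  apply PNat.coe_injective
  rw [← happ hn a k, h, happ hn]

/-! ### Monomial quasi-symmetric functions: product and independence -/

/-- The family `(n, a) ↦ x_n ^ a` of monomials. -/
noncomputable def monomialPow (n : ℕ) (a : ℕ+) : MvPowerSeries ℕ+ ℚ :=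
  MvPowerSeries.X n.toPNat' ^ (a : ℕ)

theorem monomialPow_mul (n : ℕ) (a b : ℕ+) :
    monomialPow n a * monomialPow n b = monomialPow n (a + b) := by
  simp [monomialPow, pow_add]

theorem prod_monomialPow {r : ℕ} (n : Fin r → ℕ+) (a : Fin r → ℕ+) :
    ∏ k, monomialPow (n k) (a k) =
      MvPowerSeries.monomial (∑ k, Finsupp.single (n k) (a k : ℕ)) 1 := by
  classical
  have h : ∀ s : Finset (Fin r), ∏ k ∈ s, monomialPow (n k) (a k) =
      MvPowerSeries.monomial (∑ k ∈ s, Finsupp.single (n k) (a k : ℕ)) 1 := by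
    intro s
    induction s using Finset.induction_on with
    | empty => simp [MvPowerSeries.monomial_zero_one]
    | insert k s hk ih =>
      rw [Finset.prod_insert hk, Finset.sum_insert hk, ih, monomialPow, PNat.coe_toPNat',
        MvPowerSeries.X_pow_eq, MvPowerSeries.monomial_mul_monomial, one_mul]
  exact h _

/-- A single coefficient sees only the variables in its monomial, so it is unaffected by truncation
at a large enough bound. This reduces identities between the series to `truncSum`. -/
theorem coeff_monomialSeries (I : List ℕ+) (e : ℕ+ →₀ ℕ) (N : ℕ)
    (hN : ∀ m ∈ e.support, (m : ℕ) ≤ N) :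
    MvPowerSeries.coeff e (monomialSeries I) =
      MvPowerSeries.coeff e (truncSum monomialPow N I) := by
  classical
  rw [truncSum_eq_sum, map_sum]
  simp only [prod_monomialPow, MvPowerSeries.coeff_monomial]
  change (if _ then (1 : ℚ) else 0) = _
  split_ifs with h
  · obtain ⟨n, hn, he⟩ := h
    rw [Finset.sum_eq_single_of_mem n, if_pos he]
    · rw [Finset.mem_filter, mem_boundedMaps]
      refine ⟨fun k => hN _ ?_, hn⟩
      rw [he, Finsupp.mem_support_iff, Finsupp.finsetSum_apply]
      intro h0
      have := Finset.sum_eq_zero_iff.mp h0 k (Finset.mem_univ _)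
      rw [Finsupp.single_eq_same] at this
      exact (I.get k).ne_zero this
    · intro m hm hmn
      rw [if_neg]
      intro he'
      apply hmn
      exact List.ofFn_injective (strictAnti_eq_of_sum_single_eq (Finset.mem_filter.mp hm).2 hn
        (he'.symm.trans he)).1
  · rw [Finset.sum_eq_zero]
    intro n hn
    rw [if_neg]
    exact fun he => h ⟨n, (Finset.mem_filter.mp hn).2, he⟩

theorem monomialSeries_mul (I J : List ℕ+) :
    monomialSeries I * monomialSeries J = ((stuffle I J).map monomialSeries).sum := by
  classical
  ext e
  obtain ⟨N, hN⟩ : ∃ N : ℕ, ∀ m ∈ e.support, (m : ℕ) ≤ N :=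
    ⟨e.support.sup fun m => (m : ℕ), fun m hm => Finset.le_sup (f := fun m : ℕ+ => (m : ℕ)) hm⟩
  have h1 : MvPowerSeries.coeff e (monomialSeries I * monomialSeries J) =
      MvPowerSeries.coeff e (truncSum monomialPow N I * truncSum monomialPow N J) := by
    rw [MvPowerSeries.coeff_mul, MvPowerSeries.coeff_mul]
    refine Finset.sum_congr rfl fun p hp => ?_
    rw [Finset.HasAntidiagonal.mem_antidiagonal] at hp
    rw [coeff_monomialSeries I p.1 N, coeff_monomialSeries J p.2 N]
    · intro m hm
      refine hN m ?_
      rw [Finsupp.mem_support_iff] at hm ⊢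
      rw [← hp, Finsupp.add_apply]
      omega
    · intro m hm
      refine hN m ?_
      rw [Finsupp.mem_support_iff] at hm ⊢
      rw [← hp, Finsupp.add_apply]
      omega
  rw [h1, truncSum_mul _ monomialPow_mul, map_multiset_sum, map_multiset_sum, Multiset.map_map,
    Multiset.map_map]
  congr 1
  refine Multiset.map_congr rfl fun K _ => ?_
  exact (coeff_monomialSeries K e N hN).symm

theorem monomialQSym_mul (I J : List ℕ+) :
    monomialQSym I * monomialQSym J = ((stuffle I J).map monomialQSym).sum := by
  apply Subtype.ext
  have := monomialSeries_mul I J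
  change monomialSeries I * monomialSeries J = QSym.val (Multiset.sum _)
  rw [this, map_multiset_sum, Multiset.map_map]
  rfl

theorem monomialQSym_nil : monomialQSym [] = 1 := by
  apply Subtype.ext
  ext e
  change MvPowerSeries.coeff e (monomialSeries []) = MvPowerSeries.coeff e 1
  obtain ⟨N, hN⟩ : ∃ N : ℕ, ∀ m ∈ e.support, (m : ℕ) ≤ N :=
    ⟨e.support.sup fun m => (m : ℕ), fun m hm => Finset.le_sup (f := fun m : ℕ+ => (m : ℕ)) hm⟩
  rw [coeff_monomialSeries [] e N hN, truncSum_nil]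

/-- The monomial `x_r ^ s₁ ⋯ x_1 ^ s_r`, which occurs in no other `M_I` than `M_s`. -/
noncomputable def initialExponent (s : List ℕ+) : ℕ+ →₀ ℕ :=
  ∑ k : Fin s.length, Finsupp.single (Nat.succPNat (s.length - 1 - k)) (s.get k : ℕ)

open Classical in
theorem coeff_initialExponent (s I : List ℕ+) :
    MvPowerSeries.coeff (initialExponent s) (monomialSeries I) = if I = s then 1 else 0 := by
  have hanti : StrictAnti fun k : Fin s.length => Nat.succPNat (s.length - 1 - k) := by
    intro i j hij
    rw [← PNat.coe_lt_coe]
    have := j.2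
    have : (i : ℕ) < j := hij
    simp only [Nat.succPNat_coe]
    omega
  change (if _ then (1 : ℚ) else 0) = _
  refine if_congr ⟨?_, ?_⟩ rfl rfl
  · rintro ⟨n, hn, he⟩
    have := (strictAnti_eq_of_sum_single_eq hanti hn he).2
    rw [List.ofFn_get, List.ofFn_get] at this
    exact this.symm
  · rintro rfl
    exact ⟨_, hanti, rfl⟩

theorem linearIndependent_monomialQSym : LinearIndependent ℚ monomialQSym := by
  classical
  rw [linearIndependent_iff']
  intro t c hc s hs
  have h := congrArg (fun f : QSym => MvPowerSeries.coeff (initialExponent s) f.1) hc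
  have h2 : (QSym.val.toLinearMap (∑ i ∈ t, c i • monomialQSym i)) =
      ∑ i ∈ t, c i • monomialSeries i := by
    rw [map_sum]
    rfl
  change MvPowerSeries.coeff _ (QSym.val.toLinearMap (∑ i ∈ t, c i • monomialQSym i)) = 0 at h
  rw [h2, map_sum] at h
  simpa [coeff_initialExponent, hs] using h

/-! ### Convergence, product and difference equation of the Hurwitz series -/

/-- Every finite set of index tuples lies in a box, over which the sum factors into bounded
one-variable sums. -/
theorem summable_prod_pi {r : ℕ} {ι : Type*} {g : ι → ℝ} (hg : ∀ i, 0 ≤ g i) (hs : Summable g) :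
    Summable fun n : Fin r → ι => ∏ k, g (n k) := by
  classical
  refine summable_of_sum_le (c := ∏ _k : Fin r, ∑' i, g i)
    (fun n => Finset.prod_nonneg fun k _ => hg _) fun t => ?_
  calc ∑ n ∈ t, ∏ k, g (n k)
      ≤ ∑ n ∈ Fintype.piFinset fun k => t.image fun n => n k, ∏ k, g (n k) := by
        refine Finset.sum_le_sum_of_subset_of_nonneg ?_
          fun n _ _ => Finset.prod_nonneg fun k _ => hg _
        intro n hn
        exact Fintype.mem_piFinset.mpr fun k => Finset.mem_image_of_mem (fun n => n k) hn
    _ = ∏ k : Fin r, ∑ i ∈ t.image fun n => n k, g i := by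
        rw [Finset.prod_univ_sum]
    _ ≤ ∏ _k : Fin r, ∑' i, g i :=
        Finset.prod_le_prod (fun k _ => Finset.sum_nonneg fun i _ => hg i)
          fun k _ => hs.sum_le_tsum _ fun i _ => hg i

/-- The family `(n, a) ↦ 1 / (n + z) ^ a`. -/
noncomputable def hurwitzTerm (z : ℂ) (n : ℕ) (a : ℕ+) : ℂ :=
  1 / ((n : ℂ) + z) ^ (a : ℕ)

theorem hurwitzTerm_mul (z : ℂ) (n : ℕ) (a b : ℕ+) :
    hurwitzTerm z n a * hurwitzTerm z n b = hurwitzTerm z n (a + b) := by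
  simp [hurwitzTerm, pow_add, mul_comm]

/-- The sequence `n / (n + z)` converges, hence is bounded. -/
theorem exists_norm_hurwitzTerm_le (z : ℂ) : ∃ C : ℝ, 1 ≤ C ∧
    ∀ (n : ℕ+) (a : ℕ+), ‖hurwitzTerm z n a‖ ≤ C ^ (a : ℕ) * (1 / (n : ℝ)) ^ (a : ℕ) := by
  obtain ⟨B, hB⟩ := (tendsto_natCast_div_add_atTop (𝕜 := ℂ) z).norm.bddAbove_range
  refine ⟨max B 1, le_max_right _ _, fun n a => ?_⟩
  have hn : (0 : ℝ) < (n : ℕ) := by exact_mod_cast n.pos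
  have h1 : ‖((n : ℕ) : ℂ) / (((n : ℕ) : ℂ) + z)‖ ≤ B := hB ⟨(n : ℕ), rfl⟩
  rw [hurwitzTerm, ← one_div_pow, norm_pow, ← mul_pow]
  refine pow_le_pow_left₀ (norm_nonneg _) ?_ _
  rw [mul_one_div, le_div_iff₀ hn]
  refine le_trans (le_of_eq ?_) (h1.trans (le_max_left _ _))
  rw [norm_div, norm_div, norm_one, Complex.norm_natCast]
  ring

/-- The exponent `a 0 ≥ 2` leaves a spare factor `1 / n 0`. Since `n 0` is the largest index, this
factor can be shared equally among the `r + 1` indices, which raises every exponent strictly above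
`1` and makes the majorant a product of convergent series. -/
theorem prod_one_div_pow_le {r : ℕ} {n : Fin (r + 1) → ℕ+} (hn : StrictAnti n)
    {a : Fin (r + 1) → ℕ+} (ha : 2 ≤ a 0) :
    ∏ k, (1 / (n k : ℝ)) ^ (a k : ℕ) ≤
      ∏ k, 1 / ((n k : ℕ) : ℝ) ^ (1 + 1 / ((r : ℝ) + 1)) := by
  have hpos : ∀ k, (0 : ℝ) < (n k : ℕ) := fun k => by exact_mod_cast (n k).pos
  have hone : ∀ k, 1 / ((n k : ℕ) : ℝ) ≤ 1 := fun k => by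
    rw [div_le_one (hpos k)]
    exact_mod_cast (n k).pos
  have hnonneg : ∀ k, 0 ≤ 1 / ((n k : ℕ) : ℝ) := fun k => (div_pos one_pos (hpos k)).le
  have hr : (0 : ℝ) < (r : ℝ) + 1 := by positivity
  have h1 : ∏ k, (1 / (n k : ℝ)) ^ (a k : ℕ) ≤ 1 / ((n 0 : ℕ) : ℝ) * ∏ k, 1 / ((n k : ℕ) : ℝ) := by
    rw [Fin.prod_univ_succ, Fin.prod_univ_succ, ← mul_assoc]
    refine mul_le_mul ?_ ?_ (Finset.prod_nonneg fun k _ => pow_nonneg (hnonneg _) _)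
      (mul_nonneg (hnonneg _) (hnonneg _))
    · rw [← pow_two]
      refine pow_le_pow_of_le_one (hnonneg _) (hone _) ?_
      exact_mod_cast ha
    · refine Finset.prod_le_prod (fun k _ => pow_nonneg (hnonneg _) _) fun k _ => ?_
      exact pow_le_of_le_one (hnonneg _) (hone _) (a k.succ).ne_zero
  have h2 : 1 / ((n 0 : ℕ) : ℝ) ≤ ∏ k, 1 / ((n k : ℕ) : ℝ) ^ (1 / ((r : ℝ) + 1)) := by
    calc 1 / ((n 0 : ℕ) : ℝ)
        = ∏ _k : Fin (r + 1), 1 / ((n 0 : ℕ) : ℝ) ^ (1 / ((r : ℝ) + 1)) := by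
          rw [Finset.prod_const, Finset.card_univ, Fintype.card_fin, one_div_pow,
            ← Real.rpow_natCast, ← Real.rpow_mul (hpos 0).le]
          push_cast
          rw [one_div_mul_cancel hr.ne', Real.rpow_one]
      _ ≤ _ := by
          refine Finset.prod_le_prod (fun k _ => by positivity) fun k _ => ?_
          refine one_div_le_one_div_of_le (Real.rpow_pos_of_pos (hpos k) _) ?_
          refine Real.rpow_le_rpow (hpos k).le ?_ (by positivity)
          exact_mod_cast hn.antitone (Fin.zero_le k)
  calc _ ≤ _ := h1
    _ ≤ (∏ k, 1 / ((n k : ℕ) : ℝ) ^ (1 / ((r : ℝ) + 1))) * ∏ k, 1 / ((n k : ℕ) : ℝ) :=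
        mul_le_mul_of_nonneg_right h2 (Finset.prod_nonneg fun k _ => hnonneg k)
    _ = _ := by
        rw [← Finset.prod_mul_distrib]
        refine Finset.prod_congr rfl fun k _ => ?_
        rw [Real.rpow_add (hpos k), Real.rpow_one, one_div_mul_one_div, mul_comm]

theorem summable_hurwitz (z : ℂ) (s : List ℕ+) (hs : ∀ a ∈ s.head?, 2 ≤ a) :
    Summable fun n : {n : Fin s.length → ℕ+ // StrictAnti n} =>
      ∏ k : Fin s.length, hurwitzTerm z (n.1 k) (s.get k) := by
  rcases s with - | ⟨b, u⟩
  · have : Finite {n : Fin ([] : List ℕ+).length → ℕ+ // StrictAnti n} :=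
      inferInstanceAs (Finite {n : Fin 0 → ℕ+ // StrictAnti n})
    exact Summable.of_finite
  obtain ⟨C, hC, hbound⟩ := exists_norm_hurwitzTerm_le z
  have hb : 2 ≤ b := hs b rfl
  have hg : Summable fun n : ℕ+ => 1 / ((n : ℕ) : ℝ) ^ (1 + 1 / ((u.length : ℝ) + 1)) := by
    have : Summable fun n : ℕ => 1 / (n : ℝ) ^ (1 + 1 / ((u.length : ℝ) + 1)) := by
      rw [Real.summable_one_div_nat_rpow]
      have : (0 : ℝ) < 1 / ((u.length : ℝ) + 1) := by positivity
      linarith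
    exact this.comp_injective PNat.coe_injective
  have hsum := (summable_prod_pi (r := u.length + 1) (fun n : ℕ+ => by positivity) hg).mul_left
    (∏ k : Fin (u.length + 1), C ^ ((b :: u).get k : ℕ))
  refine Summable.of_norm_bounded (hsum.comp_injective Subtype.val_injective) fun n => ?_
  change ‖∏ k : Fin (u.length + 1), _‖ ≤ _ * ∏ k : Fin (u.length + 1), _
  rw [norm_prod]
  calc ∏ k : Fin (u.length + 1), ‖hurwitzTerm z (n.1 k) ((b :: u).get k)‖
      ≤ ∏ k : Fin (u.length + 1), (C ^ ((b :: u).get k : ℕ) *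
          (1 / (n.1 k : ℝ)) ^ ((b :: u).get k : ℕ)) :=
        Finset.prod_le_prod (fun k _ => norm_nonneg _) fun k _ => hbound _ _
    _ = (∏ k : Fin (u.length + 1), C ^ ((b :: u).get k : ℕ)) *
          ∏ k : Fin (u.length + 1), (1 / (n.1 k : ℝ)) ^ ((b :: u).get k : ℕ) :=
        Finset.prod_mul_distrib
    _ ≤ _ := by
        refine mul_le_mul_of_nonneg_left (prod_one_div_pow_le n.2 hb) ?_
        exact Finset.prod_nonneg fun k _ => by positivity

theorem tendsto_truncSum_hurwitz (z : HurwitzDomain) (s : List ℕ+) (hs : ∀ a ∈ s.head?, 2 ≤ a) :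
    Filter.Tendsto (fun N => truncSum (hurwitzTerm z.1) N s) Filter.atTop
      (nhds (hurwitzMultizeta s z)) := by
  classical
  have hsum := (summable_hurwitz z.1 s hs).hasSum
  have hset : Filter.Tendsto (fun N => (boundedMaps s.length N).subtype StrictAnti) Filter.atTop
      Filter.atTop := by
    refine Filter.tendsto_atTop_finset_of_monotone ?_ ?_
    · intro M N hMN n hn
      rw [Finset.mem_subtype, mem_boundedMaps] at hn ⊢
      exact fun k => (hn k).trans hMN
    · intro n
      refine ⟨Finset.univ.sup fun k => (n.1 k : ℕ), ?_⟩
      rw [Finset.mem_subtype, mem_boundedMaps]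
      exact fun k => Finset.le_sup (f := fun k => (n.1 k : ℕ)) (Finset.mem_univ k)
  refine (hsum.comp hset).congr fun N => ?_
  rw [truncSum_eq_sum]
  exact Finset.sum_subtype_eq_sum_filter (p := StrictAnti)
    (fun n : Fin s.length → ℕ+ => ∏ k : Fin s.length, hurwitzTerm z.1 (n k) (s.get k))

theorem head_mem_stuffle {s t w : List ℕ+} (hs : ∀ a ∈ s.head?, 2 ≤ a)
    (ht : ∀ a ∈ t.head?, 2 ≤ a) (hw : w ∈ stuffle s t) : ∀ a ∈ w.head?, 2 ≤ a := by
  rcases s with - | ⟨a, u⟩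
  · rw [stuffle, Multiset.mem_singleton] at hw
    rwa [hw]
  rcases t with - | ⟨b, v⟩
  · rw [stuffle, Multiset.mem_singleton] at hw
    rwa [hw]
  rw [stuffle, Multiset.mem_add, Multiset.mem_add, Multiset.mem_map, Multiset.mem_map,
    Multiset.mem_map] at hw
  have ha : 2 ≤ a := hs a rfl
  have hb : 2 ≤ b := ht b rfl
  rcases hw with (⟨x, -, rfl⟩ | ⟨x, -, rfl⟩) | ⟨x, -, rfl⟩
  · simpa using ha
  · simpa using hb
  · simpa using ha.trans (PNat.lt_add_right a b).le

theorem hurwitzMultizeta_mul {s t : List ℕ+} (hs : ∀ a ∈ s.head?, 2 ≤ a)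
    (ht : ∀ a ∈ t.head?, 2 ≤ a) :
    hurwitzMultizeta s * hurwitzMultizeta t = ((stuffle s t).map hurwitzMultizeta).sum := by
  funext z
  have h1 := (tendsto_truncSum_hurwitz z s hs).mul (tendsto_truncSum_hurwitz z t ht)
  have h2 : Filter.Tendsto (fun N => ((stuffle s t).map (truncSum (hurwitzTerm z.1) N)).sum)
      Filter.atTop (nhds ((stuffle s t).map fun w => hurwitzMultizeta w z).sum) :=
    tendsto_multiset_sum _ fun w hw =>
      tendsto_truncSum_hurwitz z w (head_mem_stuffle hs ht hw)
  have h3 := tendsto_nhds_unique (h1.congr fun N => truncSum_mul _ (hurwitzTerm_mul z.1) N s t) h2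
  rw [Pi.mul_apply, h3]
  change _ = Pi.evalAddMonoidHom (fun _ : HurwitzDomain => ℂ) z
    ((stuffle s t).map hurwitzMultizeta).sum
  rw [map_multiset_sum, Multiset.map_map]
  rfl

theorem hurwitzMultizeta_nil : hurwitzMultizeta [] = 1 := by
  funext z
  refine tendsto_nhds_unique (tendsto_truncSum_hurwitz z [] (by simp)) ?_
  simp

/-- Limit of `truncSum_succ_concat`: the terms with smallest index `1` contribute the factor `1 / (1
+ z) ^ a`, and the shift of the other indices replaces `z` by `z + 1`. -/
theorem hurwitzMultizeta_concat (z z' : HurwitzDomain) (hz : z'.1 = z.1 + 1) (s : List ℕ+) (a : ℕ+)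
    (hs : ∀ b ∈ (s ++ [a]).head?, 2 ≤ b) :
    hurwitzMultizeta (s ++ [a]) z = hurwitzMultizeta (s ++ [a]) z' +
      1 / z'.1 ^ (a : ℕ) * hurwitzMultizeta s z' := by
  have hs' : ∀ b ∈ s.head?, 2 ≤ b := by
    rcases s with - | ⟨c, s⟩
    · simp
    · exact hs
  have hterm : (fun n => hurwitzTerm z.1 (n + 1)) = hurwitzTerm z'.1 := by
    funext n b
    rw [hurwitzTerm, hurwitzTerm, hz]
    push_cast
    ring_nf
  have h1 := (tendsto_truncSum_hurwitz z _ hs).comp (Filter.tendsto_add_atTop_nat 1)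
  refine tendsto_nhds_unique h1 ?_
  refine ((tendsto_truncSum_hurwitz z' _ hs).add
    ((tendsto_truncSum_hurwitz z' s hs').const_mul (1 / z'.1 ^ (a : ℕ)))).congr fun N => ?_
  rw [Function.comp_apply, truncSum_succ_concat, hterm]
  congr 2
  rw [hurwitzTerm, hz]
  push_cast
  ring_nf

/-! ### Rational functions under the shift by one -/

open Polynomial in
theorem eventually_eval_natCast_ne_zero {q : ℂ[X]} (hq : q ≠ 0) :
    ∀ᶠ n : ℕ in Filter.atTop, q.eval (n : ℂ) ≠ 0 := by
  rw [← Nat.cofinite_eq_atTop]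
  have h : {n : ℕ | q.eval (n : ℂ) = 0}.Finite :=
    (q.roots.toFinset.finite_toSet.preimage (Nat.cast_injective (R := ℂ)).injOn).subset
      fun n hn => by simpa [hq] using hn
  simpa [Filter.eventually_cofinite] using h

open Polynomial in
theorem eq_of_frequently_eval_natCast_eq {p q : ℂ[X]}
    (h : ∃ᶠ n : ℕ in Filter.atTop, p.eval (n : ℂ) = q.eval (n : ℂ)) : p = q := by
  by_contra hne
  apply h
  filter_upwards [eventually_eval_natCast_ne_zero (sub_ne_zero.mpr hne)] with n hn
  rwa [eval_sub, sub_ne_zero] at hn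

open Polynomial in
/-- The substitution `X ↦ X - 1`. -/
noncomputable def shiftPoly : ℂ[X] →+* ℂ[X] := compRingHom (X - 1)

open Polynomial in
theorem eval_shiftPoly (p : ℂ[X]) (z : ℂ) : (shiftPoly p).eval z = p.eval (z - 1) := by
  simp [shiftPoly]

open Polynomial in
theorem shiftPoly_C (c : ℂ) : shiftPoly (C c) = C c := by
  simp [shiftPoly]

open Polynomial in
theorem shiftPoly_ne_zero {p : ℂ[X]} (hp : p ≠ 0) : shiftPoly p ≠ 0 := by
  intro h
  obtain ⟨n, hn⟩ := (eventually_eval_natCast_ne_zero hp).exists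
  have := eval_shiftPoly p (n + 1)
  rw [h, eval_zero, add_sub_cancel_right] at this
  exact hn this.symm

open Polynomial in
/-- A rational function `p / q` of period `1` is constant. -/
theorem exists_eq_C_mul_of_mul_shiftPoly_eq {p q : ℂ[X]} (hq : q ≠ 0)
    (h : q * shiftPoly p = shiftPoly q * p) : ∃ c, p = C c * q := by
  -- Beyond the integer zeros of `q`, the relation says that `p / q` takes the same value at
  -- consecutive integers. Agreement at infinitely many points gives the polynomial identity.
  obtain ⟨n₀, hn₀⟩ := Filter.eventually_atTop.mp (eventually_eval_natCast_ne_zero hq)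
  refine ⟨p.eval (n₀ : ℂ) / q.eval (n₀ : ℂ), eq_of_frequently_eval_natCast_eq
    (Filter.Eventually.frequently (Filter.eventually_atTop.mpr ⟨n₀, fun n hn => ?_⟩))⟩
  rw [eval_mul, eval_C]
  induction n, hn using Nat.le_induction with
  | base => rw [div_mul_cancel₀ _ (hn₀ _ le_rfl)]
  | succ n hn ih =>
    have h1 := congrArg (eval ((n : ℂ) + 1)) h
    rw [eval_mul, eval_mul, eval_shiftPoly, eval_shiftPoly, add_sub_cancel_right, ih] at h1
    have := hn₀ n hn
    push_cast
    apply mul_left_cancel₀ this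
    rw [← h1]
    ring

open Polynomial in
/-- No combination of `z⁻¹, …, z⁻ᴬ` has the form `R(z) - R(z - 1)` with `R = p / q` rational. -/
theorem X_pow_mul_telescope_ne_zero {p q b : ℂ[X]} {A : ℕ} (hq : q ≠ 0) (hb : b ≠ 0)
    (hA : b.natDegree < A) :
    (q * shiftPoly p - shiftPoly q * p) * X ^ A + q * shiftPoly q * b ≠ 0 := by
  intro h
  -- Put `R = p / q` in lowest terms `p₁ / q₁`, so that the roots of `q₁` are its actual poles.
  obtain ⟨p₁, hp₁⟩ := EuclideanDomain.gcd_dvd_right q p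
  obtain ⟨q₁, hq₁⟩ := EuclideanDomain.gcd_dvd_left q p
  set g := EuclideanDomain.gcd q p with hg
  have hg0 : g ≠ 0 := fun h0 => hq (by rw [hq₁, h0, zero_mul])
  have hcop : IsCoprime q₁ p₁ := by
    have h1 := EuclideanDomain.gcd_eq_gcd_ab q p
    refine ⟨EuclideanDomain.gcdA q p, EuclideanDomain.gcdB q p, mul_left_cancel₀ hg0 ?_⟩
    rw [← hg] at h1
    calc _ = (g * q₁) * EuclideanDomain.gcdA q p + (g * p₁) * EuclideanDomain.gcdB q p := by ring
      _ = g * 1 := by rw [← hq₁, ← hp₁, ← h1, mul_one]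
  have hq₁0 : q₁ ≠ 0 := fun h0 => hq (by rw [hq₁, h0, mul_zero])
  have h' : (q₁ * shiftPoly p₁ - shiftPoly q₁ * p₁) * X ^ A + q₁ * shiftPoly q₁ * b = 0 := by
    apply (mul_eq_zero.mp _).resolve_left (mul_ne_zero hg0 (shiftPoly_ne_zero hg0))
    rw [hp₁, hq₁, map_mul, map_mul] at h
    linear_combination h
  -- Reduced modulo `q₁`, and then modulo its shift, the relation makes the poles of `R` stable
  -- under `z ↦ z - 1` and `z ↦ z + 1`, except where the factor `X ^ A` vanishes.
  have hd₁ : q₁ ∣ shiftPoly q₁ * X ^ A := by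
    refine hcop.dvd_of_dvd_mul_left (Dvd.intro (shiftPoly p₁ * X ^ A + shiftPoly q₁ * b) ?_)
    linear_combination h'
  have hd₂ : shiftPoly q₁ ∣ q₁ * X ^ A := by
    refine (hcop.map shiftPoly).dvd_of_dvd_mul_left (Dvd.intro (p₁ * X ^ A - q₁ * b) ?_)
    linear_combination -h'
  have hdown : ∀ z, q₁.eval z = 0 → z ≠ 0 → q₁.eval (z - 1) = 0 := by
    intro z hz hz0
    have := eval_eq_zero_of_dvd_of_eval_eq_zero hd₁ hz
    rw [eval_mul, eval_shiftPoly, eval_pow, eval_X] at this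
    exact (mul_eq_zero.mp this).resolve_right (pow_ne_zero _ hz0)
  have hup : ∀ z, q₁.eval z = 0 → z + 1 ≠ 0 → q₁.eval (z + 1) = 0 := by
    intro z hz hz0
    have := eval_eq_zero_of_dvd_of_eval_eq_zero hd₂ (x := z + 1)
      (by rwa [eval_shiftPoly, add_sub_cancel_right])
    rw [eval_mul, eval_pow, eval_X] at this
    exact (mul_eq_zero.mp this).resolve_right (pow_ne_zero _ hz0)
  -- From a pole at a natural number go up, from any other pole go down. Neither path is stopped at
  -- `0`, so `q₁` would have infinitely many roots.
  have hroot : ∀ z, q₁.eval z ≠ 0 := by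
    intro z hz
    apply hq₁0
    by_cases hn : ∃ n : ℕ, z = n
    · obtain ⟨n, rfl⟩ := hn
      refine eq_zero_of_infinite_isRoot _ (Set.infinite_of_injective_forall_mem
        (f := fun k : ℕ => (n : ℂ) + k) (fun i j hij => by simpa using hij) fun k => ?_)
      induction k with
      | zero => simpa using hz
      | succ k ih =>
        have := hup _ ih (by exact_mod_cast Nat.succ_ne_zero (n + k))
        simpa [add_assoc] using this
    · refine eq_zero_of_infinite_isRoot _ (Set.infinite_of_injective_forall_mem
        (f := fun k : ℕ => z - k) (fun i j hij => by simpa using hij) fun k => ?_)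
      induction k with
      | zero => simpa using hz
      | succ k ih =>
        have := hdown _ ih (fun h0 => hn ⟨k, sub_eq_zero.mp h0⟩)
        simpa [sub_sub] using this
  have hdeg : q₁.degree ≤ 0 := by
    by_contra hlt
    obtain ⟨z, hz⟩ := Complex.exists_root (not_le.mp hlt)
    exact hroot z hz
  -- Now `R` is a polynomial, so `X ^ A` divides `b`, whose degree is too small.
  rw [eq_C_of_degree_le_zero hdeg, shiftPoly_C] at h'
  have hc : q₁.coeff 0 ≠ 0 := by
    intro hc
    rw [eq_C_of_degree_le_zero hdeg, hc, C_0] at hq₁0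
    exact hq₁0 rfl
  have hdvd : X ^ A ∣ C (q₁.coeff 0) * C (q₁.coeff 0) * b :=
    Dvd.intro_left (-(C (q₁.coeff 0) * shiftPoly p₁ - C (q₁.coeff 0) * p₁))
      (by linear_combination -h')
  rw [← C_mul] at hdvd
  have hdvd' : (X ^ A : ℂ[X]) ∣ b := by
    have := hdvd.mul_left (C (q₁.coeff 0 * q₁.coeff 0)⁻¹)
    rwa [← mul_assoc, ← C_mul, inv_mul_cancel₀ (mul_ne_zero hc hc), C_1, one_mul] at this
  exact hb (eq_zero_of_dvd_of_natDegree_lt hdvd' (by simpa using hA))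

/-! ### Independence of solutions of the difference equation -/

section DifferenceEquation

open Polynomial

/-- The coefficients, with respect to the functions `h s (X)`, of
`X ^ A * (q(X) * F(X - 1) - q(X - 1) * F(X))` where `F = ∑ p_s h_s`. -/
noncomputable def differenceCoeff (q : ℂ[X]) (A : ℕ) (p : List ℕ+ →₀ ℂ[X]) : List ℕ+ →₀ ℂ[X] :=
  ∑ s ∈ p.support, (Finsupp.single s ((q * shiftPoly (p s) - shiftPoly q * p s) * X ^ A) +
    if s = [] then 0 else
      Finsupp.single s.dropLast (q * shiftPoly (p s) * X ^ (A - (s.getLastD 1 : ℕ))))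

theorem differenceCoeff_apply (q : ℂ[X]) (A : ℕ) (p : List ℕ+ →₀ ℂ[X]) (t : List ℕ+) :
    differenceCoeff q A p t = (q * shiftPoly (p t) - shiftPoly q * p t) * X ^ A +
      ∑ s ∈ p.support with s ≠ [] ∧ s.dropLast = t,
        q * shiftPoly (p s) * X ^ (A - (s.getLastD 1 : ℕ)) := by
  rw [differenceCoeff, Finsupp.finsetSum_apply]
  simp only [Finsupp.add_apply]
  rw [Finset.sum_add_distrib]
  congr 1
  · simp only [Finsupp.single_apply]
    rw [Finset.sum_ite_eq' p.support t]
    split_ifs with h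
    · rfl
    · rw [Finsupp.notMem_support_iff.mp h]
      simp
  · rw [Finset.sum_filter]
    refine Finset.sum_congr rfl fun s _ => ?_
    by_cases hs : s = []
    · simp [hs]
    · rw [if_neg hs, Finsupp.single_apply]
      simp only [ne_eq, hs, not_false_eq_true, true_and]

/-- Evaluation is at `X = n + 1`, so that `F(X - 1)` is `F(n)`. The recursion rewrites it with
values at `n + 1`, and `A`, at least every last letter, clears the denominators. -/
theorem sum_differenceCoeff {h : List ℕ+ → ℕ → ℂ} {P : List ℕ+ → Prop}
    (hrec : ∀ (u : List ℕ+) (a : ℕ+) (n : ℕ), 1 ≤ n → P (u ++ [a]) →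
      h (u ++ [a]) n = h (u ++ [a]) (n + 1) + 1 / ((n : ℂ) + 1) ^ (a : ℕ) * h u (n + 1))
    (hnil : ∀ n, h [] n = 1) {p : List ℕ+ →₀ ℂ[X]} (hp : ∀ s ∈ p.support, P s) (q : ℂ[X]) {A : ℕ}
    (hA : ∀ s ∈ p.support, (s.getLastD 1 : ℕ) ≤ A) (n : ℕ) (hn1 : 1 ≤ n) :
    ((differenceCoeff q A p).sum fun s r => r.eval ((n : ℂ) + 1) * h s (n + 1)) =
      ((n : ℂ) + 1) ^ A * (q.eval ((n : ℂ) + 1) * (p.sum fun s r => r.eval (n : ℂ) * h s n) -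
        q.eval (n : ℂ) * p.sum fun s r => r.eval ((n : ℂ) + 1) * h s (n + 1)) := by
  have hadd : ∀ (s : List ℕ+) (r r' : ℂ[X]), (r + r').eval ((n : ℂ) + 1) * h s (n + 1) =
      r.eval ((n : ℂ) + 1) * h s (n + 1) + r'.eval ((n : ℂ) + 1) * h s (n + 1) := by
    intro s r r'
    rw [eval_add, add_mul]
  have hzero : ∀ s : List ℕ+, (0 : ℂ[X]).eval ((n : ℂ) + 1) * h s (n + 1) = 0 := by
    simp
  rw [differenceCoeff, ← Finsupp.sum_finsetSum_index hzero hadd, Finsupp.sum, Finsupp.sum,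
    Finset.mul_sum, Finset.mul_sum, ← Finset.sum_sub_distrib, Finset.mul_sum]
  refine Finset.sum_congr rfl fun s hs => ?_
  rw [Finsupp.sum_add_index' hzero hadd, Finsupp.sum_single_index (hzero _)]
  rcases List.eq_nil_or_concat' s with rfl | ⟨u, a, rfl⟩
  · simp only [if_true, Finsupp.sum_zero_index, hnil, eval_mul, eval_sub, eval_pow, eval_X,
      eval_shiftPoly, add_sub_cancel_right]
    ring
  · have ha : (a : ℕ) ≤ A := by simpa using hA _ hs
    have hn : (n : ℂ) + 1 ≠ 0 := by exact_mod_cast Nat.succ_ne_zero n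
    rw [if_neg (by simp), Finsupp.sum_single_index (hzero _), hrec u a n hn1 (hp _ hs)]
    simp only [eval_mul, eval_sub, eval_pow, eval_X, eval_shiftPoly, add_sub_cancel_right,
      List.dropLast_concat, List.getLastD_concat]
    rw [← Nat.sub_add_cancel ha, pow_add, Nat.add_sub_cancel]
    field_simp
    ring

/-- Only vanishing at large integers is assumed, which passes to `differenceCoeff` and suffices to
kill a polynomial. The predicate `P` stands for convergence and is inherited by prefixes. -/
theorem eq_zero_of_eventually_sum_eq_zero {h : List ℕ+ → ℕ → ℂ} {P : List ℕ+ → Prop}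
    (hP : ∀ (u : List ℕ+) (a : ℕ+), P (u ++ [a]) → P u) (hrec : ∀ (u : List ℕ+) (a : ℕ+) (n : ℕ), 1 ≤ n → P (u ++ [a]) →
      h (u ++ [a]) n = h (u ++ [a]) (n + 1) + 1 / ((n : ℂ) + 1) ^ (a : ℕ) * h u (n + 1))
    (hnil : ∀ n, h [] n = 1) (r : ℕ) (p : List ℕ+ →₀ ℂ[X]) (hp : ∀ s ∈ p.support, P s)
    (hr : ∀ s ∈ p.support, s.length < r)
    (h0 : ∀ᶠ n : ℕ in Filter.atTop, (p.sum fun s q => q.eval (n : ℂ) * h s n) = 0) : p = 0 := by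
  classical
  induction r generalizing p with
  | zero =>
    rw [← Finsupp.support_eq_empty, Finset.eq_empty_iff_forall_notMem]
    exact fun s hs => absurd (hr s hs) (Nat.not_lt_zero _)
  | succ r ih =>
    -- Inner induction on the number of words of the maximal length `r`.
    obtain ⟨k, hk⟩ : ∃ k, (p.support.filter fun s => s.length = r).card ≤ k := ⟨_, le_rfl⟩
    induction k generalizing p with
    | zero =>
      refine ih p hp (fun s hs => lt_of_le_of_ne (Nat.lt_succ_iff.mp (hr s hs)) fun hs' => ?_) h0
      rw [Nat.le_zero, Finset.card_eq_zero] at hk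
      exact absurd (Finset.mem_filter.mpr ⟨hs, hs'⟩) (hk ▸ Finset.notMem_empty s)
    | succ k ihk =>
      by_cases hex : ∃ s ∈ p.support, s.length = r
      swap
      · push Not at hex
        exact ih p hp (fun s hs =>
          lt_of_le_of_ne (Nat.lt_succ_iff.mp (hr s hs)) (hex s hs)) h0
      exfalso
      obtain ⟨s₀, hs₀, hlen⟩ := hex
      set A := p.support.sup fun s => (s.getLastD 1 : ℕ) with hA
      have hAle : ∀ s ∈ p.support, (s.getLastD 1 : ℕ) ≤ A := fun s hs =>
        Finset.le_sup (f := fun s : List ℕ+ => (s.getLastD 1 : ℕ)) hs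
      have hq : p s₀ ≠ 0 := Finsupp.mem_support_iff.mp hs₀
      have hlong : ∀ t : List ℕ+, r ≤ t.length → differenceCoeff (p s₀) A p t =
          (p s₀ * shiftPoly (p t) - shiftPoly (p s₀) * p t) * X ^ A := by
        intro t ht
        rw [differenceCoeff_apply, Finset.filter_eq_empty_iff.mpr, Finset.sum_empty, add_zero]
        rintro s hs ⟨hs1, rfl⟩
        have h1 := hr s hs
        rw [List.length_dropLast] at ht
        have := List.length_pos_iff.mpr hs1
        omega
      -- Multiplying by `p s₀` before taking the difference cancels the coefficient of `s₀` and
      -- creates no other word of length `r`, so the inner induction applies.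
      have hzero : differenceCoeff (p s₀) A p = 0 := by
        apply ihk
        · intro t ht
          rw [Finsupp.mem_support_iff, differenceCoeff_apply] at ht
          by_cases htp : t ∈ p.support
          · exact hp t htp
          · rw [Finsupp.notMem_support_iff.mp htp, map_zero, mul_zero, mul_zero, sub_zero,
              zero_mul, zero_add] at ht
            obtain ⟨s, hs, -⟩ := Finset.exists_ne_zero_of_sum_ne_zero ht
            obtain ⟨hsp, hs1, rfl⟩ := Finset.mem_filter.mp hs
            apply hP _ (s.getLast hs1)
            rw [List.dropLast_append_getLast]
            exact hp s hsp
        · intro t ht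
          by_contra hlt
          rw [Finsupp.mem_support_iff, hlong t (by omega),
            Finsupp.notMem_support_iff.mp fun htp => hlt (hr t htp)] at ht
          simp at ht
        · have h1 := h0.and ((Filter.tendsto_add_atTop_nat 1).eventually h0)
          rw [← Filter.map_add_atTop_eq_nat 1, Filter.eventually_map]
          filter_upwards [h1, Filter.eventually_ge_atTop 1] with n hn hn1
          have h2 := hn.2
          push_cast at h2 ⊢
          rw [sum_differenceCoeff hrec hnil hp _ hAle _ hn1, hn.1, h2]
          ring
        · rw [← Nat.lt_succ_iff]
          refine lt_of_lt_of_le (Finset.card_lt_card ?_) hk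
          rw [Finset.ssubset_iff_of_subset]
          · refine ⟨s₀, Finset.mem_filter.mpr ⟨hs₀, hlen⟩, fun hmem => ?_⟩
            have := (Finset.mem_filter.mp hmem).1
            rw [Finsupp.mem_support_iff, hlong _ hlen.ge] at this
            apply this
            ring
          · intro t ht
            obtain ⟨ht, htl⟩ := Finset.mem_filter.mp ht
            refine Finset.mem_filter.mpr ⟨?_, htl⟩
            by_contra htp
            rw [Finsupp.mem_support_iff, hlong _ htl.ge, Finsupp.notMem_support_iff.mp htp] at ht
            simp at ht
      -- If `s₀` is empty, only the empty word occurs, and a nonzero polynomial would vanish at all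
      -- large integers. Otherwise compare coefficients at `s₀` without its last letter.
      rcases List.eq_nil_or_concat' s₀ with rfl | ⟨t, a, rfl⟩
      · have hsupp : p = Finsupp.single [] (p []) := by
          ext1 t
          by_cases ht : t = []
          · simp [ht]
          · rw [Finsupp.single_eq_of_ne ht, ← Finsupp.notMem_support_iff]
            intro htp
            have := hr t htp
            have := List.length_pos_iff.mpr ht
            simp only [List.length_nil] at hlen
            omega
        rw [hsupp] at h0
        obtain ⟨n, hn, hn'⟩ := (h0.and (eventually_eval_natCast_ne_zero hq)).exists
        rw [Finsupp.sum_single_index (by simp), hnil, mul_one] at hn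
        exact hn' hn
      · set q := p (t ++ [a]) with hqdef
        have hconst : ∀ s ∈ p.support.filter (fun s => s ≠ [] ∧ s.dropLast = t),
            ∃ c, p s = C c * q := by
          intro s hs
          obtain ⟨hs, hs1, rfl⟩ := Finset.mem_filter.mp hs
          apply exists_eq_C_mul_of_mul_shiftPoly_eq hq
          have hl : r ≤ s.length := by
            have := List.length_pos_iff.mpr hs1
            simp at hlen
            omega
          have h1 := hlong s hl
          rw [hzero, Finsupp.zero_apply] at h1
          exact sub_eq_zero.mp ((mul_eq_zero.mp h1.symm).resolve_right (pow_ne_zero _ X_ne_zero))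
        choose! c hc using hconst
        set T := p.support.filter (fun s => s ≠ [] ∧ s.dropLast = t) with hT
        have hmem : t ++ [a] ∈ T := Finset.mem_filter.mpr ⟨hs₀, by simp, by simp⟩
        have hc0 : c (t ++ [a]) = 1 := by
          have h1 := hc _ hmem
          have h2 : (C (c (t ++ [a])) - 1) * q = 0 := by
            rw [sub_mul, one_mul, ← h1, sub_self]
          have h3 := sub_eq_zero.mp ((mul_eq_zero.mp h2).resolve_right hq)
          exact C_injective (h3.trans C_1.symm)
        have hTA : ∀ s ∈ T, (s.getLastD 1 : ℕ) ≤ A := fun s hs =>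
          hAle s (Finset.mem_filter.mp hs).1
        have haA : (a : ℕ) ≤ A := by simpa using hTA _ hmem
        -- Different one-letter extensions of `t` have different last letters, so no other term can
        -- cancel the monomial of degree `A - a`, whose coefficient is `1`.
        have hb : ∑ s ∈ T, (C (c s) * X ^ (A - (s.getLastD 1 : ℕ)) : ℂ[X]) ≠ 0 := by
          intro hb
          have h1 := congrArg (fun f => coeff f (A - a)) hb
          simp only [finsetSum_coeff, coeff_C_mul, coeff_X_pow, coeff_zero] at h1
          rw [Finset.sum_eq_single_of_mem _ hmem] at h1
          · simp [hc0] at h1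
          · intro s hs hne
            rw [if_neg, mul_zero]
            intro he
            apply hne
            have h2 := hTA s hs
            have h3 : s.getLastD 1 = a := by
              apply PNat.coe_injective
              omega
            obtain ⟨-, hs1, hs2⟩ := Finset.mem_filter.mp hs
            rcases List.eq_nil_or_concat' s with rfl | ⟨u, b, rfl⟩
            · exact absurd rfl hs1
            · simp at h3 hs2
              rw [h3, hs2]
        refine X_pow_mul_telescope_ne_zero (p := p t) hq hb ?_ ?_ (A := A)
        · refine lt_of_le_of_lt (natDegree_sum_le_of_forall_le (n := A - 1) T _ fun s hs => ?_) ?_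
          · refine (natDegree_C_mul_X_pow_le _ _).trans ?_
            have := (s.getLastD 1).pos
            omega
          · have := a.pos
            omega
        · have h1 := differenceCoeff_apply q A p t
          rw [hzero, Finsupp.zero_apply] at h1
          refine Eq.trans ?_ h1.symm
          rw [Finset.mul_sum]
          refine congrArg _ ?_
          refine Finset.sum_congr rfl fun s hs => ?_
          rw [hc s hs, map_mul, shiftPoly_C]
          ring

end DifferenceEquation

/-! ### Linear independence of the Hurwitz multizeta functions -/

/-- The point `n + 1` of `ℂ - (-ℕ)`. -/
def HurwitzDomain.ofSucc (n : ℕ) : HurwitzDomain :=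
  ⟨(n : ℂ) + 1, fun m h => by
    have : ((n + 1 + m : ℕ) : ℂ) = 0 := by
      push_cast
      rw [h]
      ring
    exact absurd (Nat.cast_eq_zero.mp this) (by omega)⟩

theorem linearIndependent_hurwitzMultizeta :
    LinearIndependent ℚ fun s : ConvIndex => hurwitzMultizeta s.1 := by
  classical
  rw [linearIndependent_iff]
  intro l hl
  set p : List ℕ+ →₀ Polynomial ℂ :=
    (l.mapRange (fun c : ℚ => Polynomial.C (c : ℂ)) (by simp)).embDomain
      (Function.Embedding.subtype _) with hpdef
  have hpapp : ∀ s : ConvIndex, p s.1 = Polynomial.C (l s : ℂ) := fun s => by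
    have := Finsupp.embDomain_apply_self (Function.Embedding.subtype _)
      (l.mapRange (fun c : ℚ => Polynomial.C (c : ℂ)) (by simp)) s
    simpa using this
  have hp : ∀ s ∈ p.support, ∀ a ∈ s.head?, (2 : ℕ+) ≤ a := by
    intro s hs
    rw [hpdef, Finsupp.support_embDomain, Finset.mem_map] at hs
    obtain ⟨t, -, rfl⟩ := hs
    exact t.2
  have hzero : p = 0 := by
    refine eq_zero_of_eventually_sum_eq_zero
      -- For `n ≥ 1` this is the value at the point `n`. The truncated subtraction assigns the value
      -- at `1` to `n = 0`, since `0` lies outside the domain; this is why the recursion is required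
      -- only for `1 ≤ n`.
      (h := fun s n => hurwitzMultizeta s (HurwitzDomain.ofSucc (n - 1)))
      (P := fun s => ∀ a ∈ s.head?, (2 : ℕ+) ≤ a) ?_ ?_ ?_
      (p.support.sup List.length + 1) p hp
      (fun s hs => Nat.lt_succ_of_le (Finset.le_sup (f := List.length) hs))
      (Filter.Eventually.of_forall fun n => ?_)
    · intro u a h
      rcases u with - | ⟨c, u⟩
      · simp
      · exact h
    · intro u a n hn h
      obtain ⟨n, rfl⟩ := Nat.exists_eq_add_of_le' hn
      have := hurwitzMultizeta_concat (HurwitzDomain.ofSucc n) (HurwitzDomain.ofSucc (n + 1))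
        (by simp [HurwitzDomain.ofSucc]) u a h
      simpa [HurwitzDomain.ofSucc] using this
    · intro n
      rw [hurwitzMultizeta_nil]
      rfl
    · have h1 := congrFun hl (HurwitzDomain.ofSucc (n - 1))
      rw [Finsupp.linearCombination_apply, Finsupp.sum, Finset.sum_apply] at h1
      rw [hpdef, Finsupp.sum_embDomain, Finsupp.sum_mapRange_index (by simp)]
      simpa [Finsupp.sum, Rat.smul_def] using h1
  ext s
  have := hpapp s
  rw [hzero, Finsupp.zero_apply] at this
  simpa using this.symm

/-! ### Lyndon words and the Lyndon factorization -/

section LexOrder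

variable {α : Type*} [LinearOrder α]

theorem append_lt_append_left_iff {a x y : List α} : a ++ x < a ++ y ↔ x < y := by
  induction a with
  | nil => rfl
  | cons c a ih => rw [List.cons_append, List.cons_append, List.cons_lt_cons_self, ih]

theorem append_le_append_left_iff {a x y : List α} : a ++ x ≤ a ++ y ↔ x ≤ y := by
  rw [← not_lt, ← not_lt, append_lt_append_left_iff]

theorem self_le_append (a x : List α) : a ≤ a ++ x := by
  conv_lhs => rw [← List.append_nil a]
  rw [append_le_append_left_iff, ← not_lt]
  exact List.not_lt_nil x

theorem append_lt_append_of_not_prefix {a b : List α} (h : a < b) (hp : ¬ a <+: b)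
    (x y : List α) : a ++ x < b ++ y := by
  induction a generalizing b with
  | nil => exact absurd (List.nil_prefix) hp
  | cons c a ih =>
    rcases b with - | ⟨d, b⟩
    · exact absurd h (List.not_lt_nil _)
    rw [List.cons_append, List.cons_append, List.cons_lt_cons_iff]
    rcases List.cons_lt_cons_iff.mp h with h' | ⟨rfl, h'⟩
    · exact Or.inl h'
    · exact Or.inr ⟨rfl, ih h' fun hab => hp ((List.prefix_cons_inj c).mpr hab)⟩

theorem append_le_append_of_length_eq {a b : List α} (h : a ≤ b) (hl : a.length = b.length)
    (x : List α) : a ++ x ≤ b ++ x := by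
  rcases h.eq_or_lt with rfl | h
  · exact le_rfl
  · exact (append_lt_append_of_not_prefix h
      (fun hp => h.ne (hp.eq_of_length hl)) x x).le

/-- Lyndon words for the order of the alphabet. -/
def LyndonWord (w : List α) : Prop :=
  w ≠ [] ∧ ∀ u v : List α, u ≠ [] → v ≠ [] → w = u ++ v → w < v

/-- First `l ++ m < m`: either the first difference between `l` and `m` decides, or `m = l ++ r` and
`m < r`. A suffix contained in `m` is at least `m`. A longer one begins with a proper suffix of `l`,
which beats `l` before either word ends. -/
theorem LyndonWord.append {l m : List α} (hl : LyndonWord l) (hm : LyndonWord m) (h : l < m) :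
    LyndonWord (l ++ m) := by
  have key : l ++ m < m := by
    by_cases hp : l <+: m
    · obtain ⟨r, hr⟩ := hp
      have hr0 : r ≠ [] := by
        rintro rfl
        rw [List.append_nil] at hr
        exact h.ne hr
      have := hm.2 l r hl.1 hr0 hr.symm
      calc l ++ m < l ++ r := append_lt_append_left_iff.mpr this
        _ = m := hr
    · simpa using append_lt_append_of_not_prefix h hp m []
  refine ⟨by simp [hl.1], fun u v hu hv huv => ?_⟩
  rcases List.append_eq_append_iff.mp huv with ⟨c, rfl, hc⟩ | ⟨c, hc, rfl⟩
  · by_cases hc0 : c = []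
    · rw [hc0, List.nil_append] at hc
      rwa [← hc]
    · exact key.trans (hm.2 c v hc0 hv hc)
  · by_cases hc0 : c = []
    · rwa [hc0, List.nil_append]
    · refine append_lt_append_of_not_prefix (hl.2 u c hu hc0 hc) (fun hp => ?_) _ _
      have h1 := hp.length_le
      have h2 := List.length_pos_iff.mpr hu
      rw [hc, List.length_append] at h1
      omega

theorem LyndonWord.append_le_append {l m : List α} (hl : LyndonWord l) (hm : LyndonWord m)
    (h : l < m) : l ++ m ≤ m ++ l :=
  ((hl.append hm h).2 l m hl.1 hm.1 rfl).le.trans (self_le_append m l)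

/-- The concatenation, in decreasing order, of a multiset of words. -/
def descFlatten (S : Multiset (List α)) : List α := (S.sort (· ≥ ·)).flatten

@[simp] theorem descFlatten_zero : descFlatten (0 : Multiset (List α)) = [] := by
  simp [descFlatten]

@[simp] theorem descFlatten_singleton (l : List α) : descFlatten {l} = l := by
  simp [descFlatten]

theorem descFlatten_cons {l : List α} {S : Multiset (List α)} (h : ∀ m ∈ S, m ≤ l) :
    descFlatten (l ::ₘ S) = l ++ descFlatten S := by
  rw [descFlatten, Multiset.sort_cons _ _ _ h, List.flatten_cons, descFlatten]

theorem exists_cons_of_ne_zero {S : Multiset (List α)} (hS : S ≠ 0) :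
    ∃ m T, S = m ::ₘ T ∧ ∀ x ∈ T, x ≤ m := by
  classical
  obtain ⟨m, hm, hmax⟩ := S.toFinset.exists_max_image id
    (by simpa [Finset.nonempty_iff_ne_empty] using hS)
  obtain ⟨T, rfl⟩ := Multiset.exists_cons_of_mem (Multiset.mem_toFinset.mp hm)
  exact ⟨m, T, rfl, fun x hx => hmax x (by simp [hx])⟩

/-- Insertion sort: `l` moves right past each larger factor `m`, and `l ++ m ≤ m ++ l` makes every
exchange increase the word. -/
theorem append_descFlatten_le {l : List α} {S : Multiset (List α)} (hl : LyndonWord l)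
    (hS : ∀ m ∈ S, LyndonWord m) : l ++ descFlatten S ≤ descFlatten (l ::ₘ S) := by
  obtain ⟨k, hk⟩ : ∃ k, S.card = k := ⟨_, rfl⟩
  induction k generalizing S with
  | zero =>
    rw [Multiset.card_eq_zero.mp hk]
    simp [descFlatten]
  | succ k ih =>
    obtain ⟨m, T, rfl, hT⟩ := exists_cons_of_ne_zero (S := S) (by rintro rfl; simp at hk)
    by_cases hml : m ≤ l
    · rw [descFlatten_cons (S := m ::ₘ T)]
      intro x hx
      rcases Multiset.mem_cons.mp hx with rfl | hx
      · exact hml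
      · exact (hT x hx).trans hml
    · rw [not_le] at hml
      have h1 := ih (S := T) (fun x hx => hS x (Multiset.mem_cons_of_mem hx)) (by simpa using hk)
      rw [descFlatten_cons hT, Multiset.cons_swap, descFlatten_cons (S := l ::ₘ T)]
      · rw [← List.append_assoc]
        refine le_trans (append_le_append_of_length_eq (hl.append_le_append
          (hS m (Multiset.mem_cons_self _ _)) hml) (by simp [add_comm]) _) ?_
        rw [List.append_assoc]
        exact append_le_append_left_iff.mpr h1
      · intro x hx
        rcases Multiset.mem_cons.mp hx with rfl | hx
        · exact hml.le
        · exact hT x hx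

/-- Prepending a Lyndon word `l` to a product of Lyndon words: the Lyndon factorization of the
result, and a bound which persists when further factors are inserted. -/
theorem exists_descFlatten_append {X : Multiset (List α)} (hX : ∀ m ∈ X, LyndonWord m)
    {l : List α} (hl : LyndonWord l) :
    ∃ Z : Multiset (List α), (∀ m ∈ Z, LyndonWord m) ∧ descFlatten Z = l ++ descFlatten X ∧
      ∀ Y : Multiset (List α), (∀ m ∈ Y, LyndonWord m) →
        l ++ descFlatten (X + Y) ≤ descFlatten (Z + Y) := by
  obtain ⟨k, hk⟩ : ∃ k, X.card = k := ⟨_, rfl⟩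
  have hdone : (∀ x ∈ X, x ≤ l) → ∃ Z : Multiset (List α), (∀ m ∈ Z, LyndonWord m) ∧
      descFlatten Z = l ++ descFlatten X ∧
      ∀ Y : Multiset (List α), (∀ m ∈ Y, LyndonWord m) →
        l ++ descFlatten (X + Y) ≤ descFlatten (Z + Y) := by
    intro h
    refine ⟨l ::ₘ X, ?_, descFlatten_cons h, fun Y hY => ?_⟩
    · simpa [hl] using hX
    · rw [Multiset.cons_add]
      refine append_descFlatten_le hl fun m hm => ?_
      rcases Multiset.mem_add.mp hm with hm | hm
      exacts [hX m hm, hY m hm]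
  induction k generalizing X l with
  | zero =>
    apply hdone
    rw [Multiset.card_eq_zero.mp hk]
    simp
  | succ k ih =>
    obtain ⟨m, T, rfl, hT⟩ := exists_cons_of_ne_zero (S := X) (by rintro rfl; simp at hk)
    by_cases hml : m ≤ l
    · apply hdone
      intro x hx
      rcases Multiset.mem_cons.mp hx with rfl | hx
      · exact hml
      · exact (hT x hx).trans hml
    rw [not_le] at hml
    have hm : LyndonWord m := hX m (Multiset.mem_cons_self _ _)
    have hTL : ∀ x ∈ T, LyndonWord x := fun x hx => hX x (Multiset.mem_cons_of_mem hx)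
    have hcardT : T.card = k := by simpa using hk
    -- When `l < m`, the two merge into the Lyndon word `l ++ m`, and the process continues with the
    -- remaining factors.
    obtain ⟨Z, hZ, hZX, hZY⟩ := ih hTL (hl.append hm hml) hcardT (fun h => by
      refine ⟨(l ++ m) ::ₘ T, ?_, descFlatten_cons h, fun Y hY => ?_⟩
      · simpa [hl.append hm hml] using hTL
      · rw [Multiset.cons_add]
        refine append_descFlatten_le (hl.append hm hml) fun x hx => ?_
        rcases Multiset.mem_add.mp hx with hx | hx
        exacts [hTL x hx, hY x hx])
    refine ⟨Z, hZ, by rw [hZX, descFlatten_cons hT, List.append_assoc], fun Y hY => ?_⟩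
    -- Extract the largest factor `y` of `Y`. If `y ≤ m`, then `m` still comes first and merges with
    -- `l`; otherwise `y` comes first and exceeds `l`, so the two are exchanged.
    obtain ⟨j, hj⟩ : ∃ j, Y.card = j := ⟨_, rfl⟩
    induction j generalizing Y with
    | zero =>
      rw [Multiset.card_eq_zero.mp hj, add_zero, add_zero, descFlatten_cons hT, hZX,
        List.append_assoc]
    | succ j ihj =>
      obtain ⟨y, Y', rfl, hY'⟩ := exists_cons_of_ne_zero (S := Y) (by rintro rfl; simp at hj)
      by_cases hym : y ≤ m
      · rw [Multiset.cons_add, descFlatten_cons, ← List.append_assoc]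
        · exact hZY _ hY
        · intro x hx
          rcases Multiset.mem_add.mp hx with hx | hx
          · exact hT x hx
          · rcases Multiset.mem_cons.mp hx with rfl | hx
            · exact hym
            · exact (hY' x hx).trans hym
      · rw [not_le] at hym
        have hy : LyndonWord y := hY y (Multiset.mem_cons_self _ _)
        have hYL : ∀ x ∈ Y', LyndonWord x := fun x hx => hY x (Multiset.mem_cons_of_mem hx)
        rw [Multiset.add_cons, Multiset.add_cons, descFlatten_cons]
        · calc l ++ (y ++ descFlatten (m ::ₘ T + Y'))
              = (l ++ y) ++ descFlatten (m ::ₘ T + Y') := (List.append_assoc _ _ _).symm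
            _ ≤ (y ++ l) ++ descFlatten (m ::ₘ T + Y') :=
                append_le_append_of_length_eq (hl.append_le_append hy (hml.trans hym))
                  (by simp [add_comm]) _
            _ = y ++ (l ++ descFlatten (m ::ₘ T + Y')) := List.append_assoc _ _ _
            _ ≤ y ++ descFlatten (Z + Y') :=
                append_le_append_left_iff.mpr (ihj Y' hYL (by simpa using hj))
            _ ≤ descFlatten (y ::ₘ (Z + Y')) := append_descFlatten_le hy fun x hx => by
                rcases Multiset.mem_add.mp hx with hx | hx
                exacts [hZ x hx, hYL x hx]
        · intro x hx
          rcases Multiset.mem_add.mp hx with hx | hx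
          · rcases Multiset.mem_cons.mp hx with rfl | hx
            · exact hym.le
            · exact (hT x hx).trans hym.le
          · exact hY' x hx

theorem lyndonWord_singleton (a : α) : LyndonWord [a] := by
  refine ⟨by simp, fun u v hu hv h => ?_⟩
  have := congrArg List.length h
  rw [List.length_append, List.length_singleton] at this
  have := List.length_pos_iff.mpr hu
  have := List.length_pos_iff.mpr hv
  omega

/-- Existence of the Lyndon factorization. -/
theorem exists_descFlatten_eq (w : List α) :
    ∃ S : Multiset (List α), (∀ m ∈ S, LyndonWord m) ∧ descFlatten S = w := by
  induction w with
  | nil => exact ⟨0, by simp, by simp⟩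
  | cons a w ih =>
    obtain ⟨X, hX, rfl⟩ := ih
    obtain ⟨Z, hZ, hZX, -⟩ := exists_descFlatten_append hX (lyndonWord_singleton a)
    exact ⟨Z, hZ, hZX⟩

/-- Such a prefix ends inside some factor `m`; its last piece is a prefix of `m`, hence at most `m ≤
l`. -/
theorem exists_suffix_le_of_prefix_flatten {l : List α} {L : List (List α)}
    (hL : ∀ m ∈ L, m ≤ l) {t : List α} (ht : t ≠ []) (htp : t <+: L.flatten) :
    ∃ c d, t = c ++ d ∧ d ≠ [] ∧ d ≤ l := by
  induction L generalizing t with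
  | nil => exact absurd (by simpa using htp) ht
  | cons m L ih =>
    have hm : m ≤ l := hL m List.mem_cons_self
    rw [List.flatten_cons] at htp
    have hcase : t ≤ m → ∃ c d, t = c ++ d ∧ d ≠ [] ∧ d ≤ l :=
      fun h => ⟨[], t, rfl, ht, h.trans hm⟩
    obtain ⟨r, hr⟩ := htp
    rcases List.append_eq_append_iff.mp hr with ⟨c, rfl, -⟩ | ⟨c, rfl, hc⟩
    · exact hcase (self_le_append _ _)
    · by_cases hc0 : c = []
      · exact hcase (by rw [hc0, List.append_nil])
      · obtain ⟨e, d, rfl, hd⟩ := ih (fun x hx => hL x (List.mem_cons_of_mem _ hx)) hc0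
          ⟨r, hc.symm⟩
        exact ⟨m ++ e, d, by simp, hd⟩

/-- If `l'` were longer than `l`, it would overrun into the later factors and end in a suffix `d ≤ l
≤ l'`, contradicting `l' < d`. -/
theorem lyndonFactor_length_le {l l' : List α} {L L' : List (List α)} (hl : l ≠ [])
    (hl' : LyndonWord l') (hL : ∀ m ∈ L, m ≤ l) (h : (l :: L).flatten = (l' :: L').flatten) :
    l'.length ≤ l.length := by
  rw [List.flatten_cons, List.flatten_cons] at h
  rcases List.append_eq_append_iff.mp h with ⟨t, rfl, ht⟩ | ⟨t, rfl, ht⟩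
  · by_cases ht0 : t = []
    · simp [ht0]
    exfalso
    obtain ⟨c, d, rfl, hd0, hd⟩ := exists_suffix_le_of_prefix_flatten hL ht0 ⟨_, ht.symm⟩
    have := hl'.2 (l ++ c) d (by simp [hl]) hd0 (by simp)
    exact absurd (this.trans_le hd) (not_lt.mpr (self_le_append _ _))
  · simp

theorem eq_of_flatten_eq {L L' : List (List α)} (hL : ∀ m ∈ L, LyndonWord m)
    (hL' : ∀ m ∈ L', LyndonWord m) (hs : L.Pairwise (· ≥ ·)) (hs' : L'.Pairwise (· ≥ ·))
    (h : L.flatten = L'.flatten) : L = L' := by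
  induction L generalizing L' with
  | nil =>
    rcases L' with - | ⟨l', L'⟩
    · rfl
    · have := (hL' l' List.mem_cons_self).1
      simp [this] at h
  | cons l L ih =>
    rcases L' with - | ⟨l', L'⟩
    · have := (hL l List.mem_cons_self).1
      simp [this] at h
    have h1 := hL l List.mem_cons_self
    have h2 := hL' l' List.mem_cons_self
    rw [List.pairwise_cons] at hs hs'
    have hlen := le_antisymm (lyndonFactor_length_le h2.1 h1 hs'.1 h.symm)
      (lyndonFactor_length_le h1.1 h2 hs.1 h)
    rw [List.flatten_cons, List.flatten_cons] at h
    obtain ⟨rfl, h'⟩ := List.append_inj h hlen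
    rw [ih (fun m hm => hL m (List.mem_cons_of_mem _ hm))
      (fun m hm => hL' m (List.mem_cons_of_mem _ hm)) hs.2 hs'.2 h']

/-- Uniqueness of the Lyndon factorization. -/
theorem descFlatten_inj {S T : Multiset (List α)} (hS : ∀ m ∈ S, LyndonWord m)
    (hT : ∀ m ∈ T, LyndonWord m) (h : descFlatten S = descFlatten T) : S = T := by
  rw [← Multiset.sort_eq S (· ≥ ·), ← Multiset.sort_eq T (· ≥ ·)]
  refine congrArg _ (eq_of_flatten_eq ?_ ?_ (Multiset.pairwise_sort _ _)
    (Multiset.pairwise_sort _ _) h)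
  · simpa using hS
  · simpa using hT

end LexOrder

/-! ### Leading words of quasi-shuffle products -/

section Stuffle

variable {α : Type*} [Add α]

theorem append_mem_stuffle (u v : List α) : u ++ v ∈ stuffle u v := by
  induction u with
  | nil => simp [stuffle]
  | cons a u ih =>
    rcases v with - | ⟨b, v⟩
    · simp [stuffle]
    · rw [stuffle]
      simp [ih]

theorem length_le_of_mem_stuffle {u v w : List α} (hw : w ∈ stuffle u v) :
    w.length ≤ u.length + v.length := by
  induction u, v using stuffle.induct generalizing w with
  | case1 v =>
    rw [stuffle, Multiset.mem_singleton] at hw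
    simp [hw]
  | case2 a u =>
    rw [stuffle, Multiset.mem_singleton] at hw
    simp [hw]
  | case3 a u b v ih1 ih2 ih3 =>
    rw [stuffle, Multiset.mem_add, Multiset.mem_add, Multiset.mem_map, Multiset.mem_map,
      Multiset.mem_map] at hw
    rcases hw with (⟨x, hx, rfl⟩ | ⟨x, hx, rfl⟩) | ⟨x, hx, rfl⟩
    · have := ih1 hx
      simp only [List.length_cons] at this ⊢
      omega
    · have := ih2 hx
      simp only [List.length_cons] at this ⊢
      omega
    · have := ih3 hx
      simp only [List.length_cons] at this ⊢
      omega

/-- The words of the quasi-shuffle product of a list of words, with multiplicity. -/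
def stuffleProd : List (List α) → Multiset (List α)
  | [] => {[]}
  | l :: L => (stuffleProd L).bind (stuffle l)

theorem flatten_mem_stuffleProd (L : List (List α)) : L.flatten ∈ stuffleProd L := by
  induction L with
  | nil => simp [stuffleProd]
  | cons l L ih =>
    rw [stuffleProd, Multiset.mem_bind]
    exact ⟨_, ih, by rw [List.flatten_cons]; exact append_mem_stuffle _ _⟩

variable [LinearOrder α]

/-- The quasi-shuffle of two words is bounded by the decreasing product of all their Lyndon
factors. -/
theorem le_descFlatten_of_mem_stuffle {u v w : List α} (hw : w ∈ stuffle u v)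
    (hlen : w.length = u.length + v.length) {X Y : Multiset (List α)}
    (hX : ∀ m ∈ X, LyndonWord m) (hY : ∀ m ∈ Y, LyndonWord m) (hu : descFlatten X = u)
    (hv : descFlatten Y = v) : w ≤ descFlatten (X + Y) := by
  induction u, v using stuffle.induct generalizing w X Y with
  | case1 v =>
    rw [stuffle, Multiset.mem_singleton] at hw
    rw [descFlatten_inj hX (by simp) (hu.trans descFlatten_zero.symm), zero_add, hv, hw]
  | case2 a u =>
    rw [stuffle, Multiset.mem_singleton] at hw
    rw [descFlatten_inj hY (by simp) (hv.trans descFlatten_zero.symm), add_zero, hu, hw]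
  | case3 a u b v ih1 ih2 ih3 =>
    rw [stuffle, Multiset.mem_add, Multiset.mem_add, Multiset.mem_map, Multiset.mem_map,
      Multiset.mem_map] at hw
    rcases hw with (⟨x, hx, rfl⟩ | ⟨x, hx, rfl⟩) | ⟨x, hx, rfl⟩
    -- Bound the tail using the Lyndon factors of `u`, then put the letter `a` back. By uniqueness
    -- of the factorization, the `Z` so obtained is `X`.
    · obtain ⟨X', hX', rfl⟩ := exists_descFlatten_eq u
      obtain ⟨Z, hZ, hZX, hZY⟩ := exists_descFlatten_append hX' (lyndonWord_singleton a)
      have h1 := ih1 hx (by simp only [List.length_cons] at hlen ⊢; omega) hX' hY rfl hv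
      rw [descFlatten_inj hX hZ (hu.trans hZX.symm)]
      exact (append_le_append_left_iff (a := [a]).mpr h1).trans (hZY Y hY)
    · obtain ⟨Y', hY', rfl⟩ := exists_descFlatten_eq v
      obtain ⟨Z, hZ, hZY', hZX⟩ := exists_descFlatten_append hY' (lyndonWord_singleton b)
      have h1 := ih2 hx (by simp only [List.length_cons] at hlen ⊢; omega) hX hY' hu rfl
      rw [descFlatten_inj hY hZ (hv.trans hZY'.symm), add_comm]
      rw [add_comm] at h1
      exact (append_le_append_left_iff (a := [b]).mpr h1).trans (hZX X hX)
    · have := length_le_of_mem_stuffle hx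
      simp only [List.length_cons] at hlen
      omega

/-- Monotonicity of the maximal-length part. Imitate the shuffle producing `w` as long as `v` and
`u` agree; at the first difference the larger letter of `u` wins, and the rest may be arbitrary. -/
theorem exists_mem_stuffle_le {x v u w : List α} (hvu : v ≤ u) (hl : v.length = u.length)
    (hw : w ∈ stuffle x v) (hlen : w.length = x.length + v.length) :
    ∃ w' ∈ stuffle x u, w'.length = x.length + u.length ∧ w ≤ w' := by
  induction x, v using stuffle.induct generalizing w u with
  | case1 v =>
    rw [stuffle, Multiset.mem_singleton] at hw
    exact ⟨u, by simp [stuffle], by simp, by rwa [hw]⟩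
  | case2 a x =>
    rw [stuffle, Multiset.mem_singleton] at hw
    rw [List.length_nil, eq_comm, List.length_eq_zero_iff] at hl
    exact ⟨a :: x, by simp [hl, stuffle], by simp [hl], by rw [hw]⟩
  | case3 a x c v ih1 ih2 ih3 =>
    rcases u with - | ⟨d, u⟩
    · simp at hl
    rw [stuffle, Multiset.mem_add, Multiset.mem_add, Multiset.mem_map, Multiset.mem_map,
      Multiset.mem_map] at hw
    have hcons : ∀ {e : α} {y y' : List α}, y ≤ y' → e :: y ≤ e :: y' := fun {e y y'} h =>
      append_le_append_left_iff (a := [e]).mpr h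
    rcases hw with (⟨y, hy, rfl⟩ | ⟨y, hy, rfl⟩) | ⟨y, hy, rfl⟩
    · obtain ⟨w', hw', hlen', hle⟩ := ih1 hvu hl hy
        (by simp only [List.length_cons] at hlen ⊢; omega)
      refine ⟨a :: w', ?_, ?_, hcons hle⟩
      · rw [stuffle]
        simp [hw']
      · simp only [List.length_cons] at hlen' ⊢
        omega
    · rcases hvu.eq_or_lt with he | hlt
      · obtain ⟨rfl, rfl⟩ := List.cons.inj he
        refine ⟨c :: y, ?_, hlen, le_rfl⟩
        rw [stuffle]
        simp [hy]
      rcases List.cons_lt_cons_iff.mp hlt with hcd | ⟨rfl, hvu'⟩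
      · refine ⟨d :: (a :: x ++ u), ?_, ?_, (List.cons_lt_cons_iff.mpr (Or.inl hcd)).le⟩
        · rw [stuffle]
          simp only [Multiset.mem_add, Multiset.mem_map]
          exact Or.inl (Or.inr ⟨_, append_mem_stuffle _ _, rfl⟩)
        · simp only [List.length_cons, List.length_append, List.cons_append]
          omega
      · obtain ⟨w', hw', hlen', hle⟩ := ih2 hvu'.le (by simpa using hl) hy
          (by simp only [List.length_cons] at hlen ⊢; omega)
        refine ⟨c :: w', ?_, ?_, hcons hle⟩
        · rw [stuffle]
          simp only [Multiset.mem_add, Multiset.mem_map]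
          exact Or.inl (Or.inr ⟨_, hw', rfl⟩)
        · simp only [List.length_cons] at hlen' ⊢
          omega
    · have := length_le_of_mem_stuffle hy
      simp only [List.length_cons] at hlen
      omega

/-- In the quasi-shuffle product of a decreasing list of Lyndon words, the concatenation is the
leading word: the lexicographically largest of those of maximal length. -/
theorem le_flatten_of_mem_stuffleProd {L : List (List α)} (hL : ∀ m ∈ L, LyndonWord m)
    (hs : L.Pairwise (· ≥ ·)) {w : List α} (hw : w ∈ stuffleProd L) :
    w.length ≤ L.flatten.length ∧ (w.length = L.flatten.length → w ≤ L.flatten) := by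
  induction L generalizing w with
  | nil =>
    rw [stuffleProd, Multiset.mem_singleton] at hw
    simp [hw]
  | cons l L ih =>
    rw [stuffleProd, Multiset.mem_bind] at hw
    obtain ⟨v, hv, hw⟩ := hw
    rw [List.pairwise_cons] at hs
    have hLL : ∀ m ∈ L, LyndonWord m := fun m hm => hL m (List.mem_cons_of_mem _ hm)
    obtain ⟨h1, h2⟩ := ih hLL hs.2 hv
    have h3 := length_le_of_mem_stuffle hw
    rw [List.flatten_cons, List.length_append]
    refine ⟨h3.trans (Nat.add_le_add_left h1 _), fun hlen => ?_⟩
    have h4 : v.length = L.flatten.length := by omega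
    obtain ⟨w', hw', hlen', hle⟩ := exists_mem_stuffle_le (h2 h4) h4 hw (by omega)
    refine hle.trans ?_
    have hflat : descFlatten (L : Multiset (List α)) = L.flatten := by
      rw [descFlatten, Multiset.coe_sort, List.mergeSort_eq_self _ (by simpa using hs.2)]
    have h5 := le_descFlatten_of_mem_stuffle hw' hlen' (X := {l}) (Y := L)
      (by simpa using hL l List.mem_cons_self) (by simpa using hLL)
      (descFlatten_singleton l) hflat
    rwa [Multiset.singleton_add, descFlatten_cons (by simpa using hs.1), hflat] at h5

end Stuffle

/-! ### The top letter, convergence and the order `y₁ > y₂ > ⋯` -/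

section TopLetter

variable {α : Type*} [LinearOrder α]

/-- A Lyndon word of length at least two is smaller than its last letter, which is impossible if it
starts with the top letter. -/
theorem LyndonWord.head_ne_of_forall_le {t : α} (ht : ∀ a, a ≤ t) {l : List α} (hl : LyndonWord l)
    (hne : l ≠ [t]) : ∀ a ∈ l.head?, a ≠ t := by
  rcases l with - | ⟨a, v⟩
  · simp
  rcases List.eq_nil_or_concat' v with rfl | ⟨u, b, rfl⟩
  · simpa using hne
  · have h := hl.2 (a :: u) [b] (by simp) (by simp) rfl
    intro a' ha' hat
    obtain rfl : a = a' := by simpa using ha'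
    rcases List.cons_lt_cons_iff.mp h with h | ⟨-, h⟩
    · exact absurd (ht b) (not_le.mpr (hat ▸ h))
    · exact List.not_lt_nil _ h

/-- If `[t]` is a factor, the largest factor is at least `[t]`, so it, and with it the whole word,
starts with `t`. -/
theorem singleton_notMem_of_head_ne {t : α} {S : Multiset (List α)}
    (ht : ∀ a, a ≤ t) (hS : ∀ m ∈ S, LyndonWord m)
    (h : ∀ a ∈ (descFlatten S).head?, a ≠ t) : [t] ∉ S := by
  intro hmem
  obtain ⟨m, T, rfl, hT⟩ := exists_cons_of_ne_zero (S := S) (by rintro rfl; simp at hmem)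
  have hm : [t] ≤ m := by
    rcases Multiset.mem_cons.mp hmem with h | h
    · exact h.le
    · exact hT _ h
  rw [descFlatten_cons hT] at h
  rcases m with - | ⟨a, m⟩
  · exact (hS [] (Multiset.mem_cons_self _ _)).1 rfl
  · refine absurd hm (not_le.mpr (List.cons_lt_cons_iff.mpr (Or.inl ?_)))
    exact lt_of_le_of_ne (ht a) (h a (by simp))

end TopLetter

/-- The order `y₁ > y₂ > ⋯` of the letters. -/
abbrev revOrder : LinearOrder ℕ+ := inferInstanceAs (LinearOrder ℕ+ᵒᵈ)

/-- Lyndon words for the order `y₁ > y₂ > ⋯`. -/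
abbrev IsRevLyndon (w : List ℕ+) : Prop := IsLyndon (fun a b : ℕ+ => b < a) w

/-- The decreasing list of the words of a multiset, lexicographically for `y₁ > y₂ > ⋯`. -/
def revSort (S : Multiset (List ℕ+)) : List (List ℕ+) :=
  letI := revOrder
  S.sort (· ≥ ·)

/-- The comparison of words first by length, then lexicographically for `y₁ > y₂ > ⋯`. -/
def revKey (w : List ℕ+) : ℕ ×ₗ List ℕ+ᵒᵈ := toLex (w.length, w)

theorem revKey_injective : Function.Injective revKey := fun _ _ h =>
  congrArg (fun p => (ofLex p).2) h

theorem coe_revSort (S : Multiset (List ℕ+)) : (revSort S : Multiset (List ℕ+)) = S :=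
  letI := revOrder
  Multiset.sort_eq S (· ≥ ·)

/-- For the instance `revOrder`, `LyndonWord` unfolds to `IsRevLyndon` and `descFlatten` to the
flattened `revSort`, so the general results transfer definitionally. -/
theorem flatten_revSort_inj {S T : Multiset (List ℕ+)} (hS : ∀ m ∈ S, IsRevLyndon m)
    (hT : ∀ m ∈ T, IsRevLyndon m) (h : (revSort S).flatten = (revSort T).flatten) : S = T :=
  @descFlatten_inj ℕ+ revOrder S T hS hT h

theorem IsLyndon.two_le_head {l : List ℕ+} (hl : IsRevLyndon l) (hne : l ≠ [1]) :
    ∀ a ∈ l.head?, 2 ≤ a := by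
  intro a ha
  have h := @LyndonWord.head_ne_of_forall_le ℕ+ revOrder 1 (fun a => (one_le : 1 ≤ a)) l hl hne a ha
  exact PNat.add_one_le_iff.mpr (lt_of_le_of_ne (one_le : 1 ≤ a) (Ne.symm h))

theorem exists_flatten_revSort_eq {w : List ℕ+} (hw : ∀ a ∈ w.head?, 2 ≤ a) :
    ∃ S : Multiset (List ℕ+), (∀ m ∈ S, IsRevLyndon m ∧ m ≠ [1]) ∧ (revSort S).flatten = w := by
  obtain ⟨S, hS, h⟩ := @exists_descFlatten_eq ℕ+ revOrder w
  refine ⟨S, fun m hm => ⟨hS m hm, ?_⟩, h⟩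
  rintro rfl
  refine @singleton_notMem_of_head_ne ℕ+ revOrder 1 S (fun a => (one_le : 1 ≤ a)) hS (fun a ha h1 => ?_) hm
  rw [h] at ha
  have := hw a ha
  rw [h1] at this
  exact absurd this (by decide)

theorem revKey_le_of_mem_stuffleProd {S : Multiset (List ℕ+)} (hS : ∀ m ∈ S, IsRevLyndon m)
    {w : List ℕ+} (hw : w ∈ stuffleProd (revSort S)) :
    revKey w ≤ revKey (revSort S).flatten := by
  have h := @le_flatten_of_mem_stuffleProd ℕ+ _ revOrder (revSort S)
    (fun m hm => hS m (by rwa [← coe_revSort S])) (letI := revOrder; Multiset.pairwise_sort S (· ≥ ·)) w hw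
  rw [revKey, revKey, Prod.Lex.toLex_le_toLex]
  exact h.1.lt_or_eq.imp_right fun he => ⟨he, h.2 he⟩

theorem forall_mem_stuffleProd_head {L : List (List ℕ+)} (hL : ∀ l ∈ L, ∀ a ∈ l.head?, 2 ≤ a)
    {w : List ℕ+} (hw : w ∈ stuffleProd L) : ∀ a ∈ w.head?, 2 ≤ a := by
  induction L generalizing w with
  | nil =>
    rw [stuffleProd, Multiset.mem_singleton] at hw
    simp [hw]
  | cons l L ih =>
    rw [stuffleProd, Multiset.mem_bind] at hw
    obtain ⟨v, hv, hw⟩ := hw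
    exact head_mem_stuffle (hL l List.mem_cons_self)
      (ih (fun m hm => hL m (List.mem_cons_of_mem _ hm)) hv) hw

/-- The weight of a word. -/
def wordWeight (w : List ℕ+) : ℕ := (w.map fun a : ℕ+ => (a : ℕ)).sum

theorem wordWeight_of_mem_stuffle {u v w : List ℕ+} (hw : w ∈ stuffle u v) :
    wordWeight w = wordWeight u + wordWeight v := by
  induction u, v using stuffle.induct generalizing w with
  | case1 v =>
    rw [stuffle, Multiset.mem_singleton] at hw
    simp [hw, wordWeight]
  | case2 a u =>
    rw [stuffle, Multiset.mem_singleton] at hw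
    simp [hw, wordWeight]
  | case3 a u b v ih1 ih2 ih3 =>
    rw [stuffle, Multiset.mem_add, Multiset.mem_add, Multiset.mem_map, Multiset.mem_map,
      Multiset.mem_map] at hw
    simp only [wordWeight, List.map_cons, List.sum_cons] at ih1 ih2 ih3 ⊢
    rcases hw with (⟨x, hx, rfl⟩ | ⟨x, hx, rfl⟩) | ⟨x, hx, rfl⟩
    · have := ih1 hx
      simp only [List.map_cons, List.sum_cons]
      omega
    · have := ih2 hx
      simp only [List.map_cons, List.sum_cons]
      omega
    · have := ih3 hx
      simp only [List.map_cons, List.sum_cons, PNat.add_coe]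
      omega

theorem wordWeight_of_mem_stuffleProd {L : List (List ℕ+)} {w : List ℕ+}
    (hw : w ∈ stuffleProd L) : wordWeight w = wordWeight L.flatten := by
  induction L generalizing w with
  | nil =>
    rw [stuffleProd, Multiset.mem_singleton] at hw
    simp [hw]
  | cons l L ih =>
    rw [stuffleProd, Multiset.mem_bind] at hw
    obtain ⟨v, hv, hw⟩ := hw
    rw [wordWeight_of_mem_stuffle hw, ih hv, List.flatten_cons]
    simp [wordWeight]

theorem finite_setOf_wordWeight_eq (n : ℕ) : {w : List ℕ+ | wordWeight w = n}.Finite := by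
  have hinj : Function.Injective (List.map fun a : ℕ+ => (a : ℕ)) :=
    List.map_injective_iff.mpr PNat.coe_injective
  refine Set.Finite.of_finite_image (f := List.map fun a : ℕ+ => (a : ℕ)) ?_ hinj.injOn
  refine (Set.finite_range fun c : Composition n => c.blocks).subset ?_
  rintro - ⟨w, hw, rfl⟩
  exact ⟨⟨w.map fun a : ℕ+ => (a : ℕ), by simp, hw⟩, rfl⟩

/-! ### Triangular families -/

section Triangular

variable {ι W V κ : Type*} [LinearOrder κ] [AddCommGroup V] [Module ℚ V]

/-- In a relation, take the index with nonzero coefficient and largest leading word. No other term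
contains this word, and its multiplicity is a positive integer, nonzero in `ℚ`. -/
theorem linearIndependent_of_triangular {key : W → κ} (hkey : Function.Injective key) {M : W → V}
    (hM : LinearIndependent ℚ M) {G : ι → W} (hG : Function.Injective G) {T : ι → Multiset W}
    (hmem : ∀ i, G i ∈ T i) (hle : ∀ i, ∀ w ∈ T i, key w ≤ key (G i)) :
    LinearIndependent ℚ fun i => ((T i).map M).sum := by
  classical
  set F : ι → W →₀ ℚ := fun i => ((T i).map fun w => Finsupp.single w 1).sum with hF
  have hcount : ∀ (s : Multiset W) (w : W),
      (s.map fun w => Finsupp.single w (1 : ℚ)).sum w = s.count w := by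
    intro s w
    induction s using Multiset.induction_on with
    | empty => simp
    | cons a s ih =>
      rw [Multiset.map_cons, Multiset.sum_cons, Finsupp.add_apply, ih, Multiset.count_cons]
      by_cases h : w = a
      · rw [h, Finsupp.single_eq_same, if_pos rfl]
        push_cast
        ring
      · rw [Finsupp.single_eq_of_ne h, if_neg h, zero_add, add_zero]
  have hFapp : ∀ i w, F i w = (T i).count w := fun i w => hcount (T i) w
  have hFM : ∀ i, Finsupp.linearCombination ℚ M (F i) = ((T i).map M).sum := by
    intro i
    rw [hF, map_multiset_sum, Multiset.map_map]
    congr 1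
    exact Multiset.map_congr rfl fun w _ => by simp
  rw [linearIndependent_iff']
  intro s c hc
  have hzero : ∑ i ∈ s, c i • F i = 0 := by
    apply (linearIndependent_iff.mp hM)
    rw [map_sum, ← hc]
    exact Finset.sum_congr rfl fun i _ => by rw [map_smul, hFM]
  by_contra! hex
  obtain ⟨j, hj, hcj⟩ := hex
  obtain ⟨i, hi, hmax⟩ := (s.filter fun i => c i ≠ 0).exists_max_image (fun i => key (G i))
    ⟨j, Finset.mem_filter.mpr ⟨hj, hcj⟩⟩
  obtain ⟨his, hci⟩ := Finset.mem_filter.mp hi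
  have h := DFunLike.congr_fun hzero (G i)
  rw [Finsupp.finsetSum_apply, Finset.sum_eq_single_of_mem i his] at h
  · rw [Finsupp.smul_apply, hFapp, Finsupp.zero_apply, smul_eq_mul] at h
    have := (mul_eq_zero.mp h).resolve_left hci
    rw [Nat.cast_eq_zero, Multiset.count_eq_zero] at this
    exact this (hmem i)
  · intro k hk hki
    rw [Finsupp.smul_apply, hFapp, smul_eq_mul]
    by_cases hck : c k = 0
    · rw [hck, zero_mul]
    · rw [Multiset.count_eq_zero.mpr, Nat.cast_zero, mul_zero]
      intro hmemk
      exact hki (hG (hkey (le_antisymm (hmax k (Finset.mem_filter.mpr ⟨hk, hck⟩))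
        (hle k _ hmemk))))

/-- Solve for the leading word, whose multiplicity is invertible in `ℚ`. The other words are smaller
and of equal weight, and finiteness of the weight levels makes the descent terminate. -/
theorem span_eq_of_triangular {key : W → κ} (hkey : Function.Injective key) {M : W → V}
    {G : ι → W} {T : ι → Multiset W} (hmem : ∀ i, G i ∈ T i)
    (hle : ∀ i, ∀ w ∈ T i, key w ≤ key (G i)) (hrange : ∀ i, ∀ w ∈ T i, w ∈ Set.range G)
    {wt : W → ℕ} (hwt : ∀ i, ∀ w ∈ T i, wt w = wt (G i)) (hfin : ∀ n, {w | wt w = n}.Finite) :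
    Submodule.span ℚ (Set.range fun i => ((T i).map M).sum) =
      Submodule.span ℚ (M '' Set.range G) := by
  classical
  apply le_antisymm
  · rw [Submodule.span_le]
    rintro - ⟨i, rfl⟩
    refine multiset_sum_mem _ fun x hx => ?_
    obtain ⟨w, hw, rfl⟩ := Multiset.mem_map.mp hx
    exact Submodule.subset_span ⟨w, hrange i w hw, rfl⟩
  · rw [Submodule.span_le]
    rintro - ⟨-, ⟨i, rfl⟩, rfl⟩
    have hlow : ∀ i, {w | wt w = wt (G i) ∧ key w < key (G i)}.Finite := fun i =>
      (hfin (wt (G i))).subset fun w hw => hw.1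
    obtain ⟨k, hk⟩ : ∃ k, {w | wt w = wt (G i) ∧ key w < key (G i)}.ncard < k :=
      ⟨_, Nat.lt_succ_self _⟩
    induction k generalizing i with
    | zero => exact absurd hk (Nat.not_lt_zero _)
    | succ k ih =>
      set N := Submodule.span ℚ (Set.range fun i => ((T i).map M).sum)
      have hb : ((T i).map M).sum ∈ N := Submodule.subset_span ⟨i, rfl⟩
      have hfilter : (T i).filter (fun w => w = G i) =
          Multiset.replicate ((T i).count (G i)) (G i) := by
        convert Multiset.filter_eq' (T i) (G i)
      rw [← Multiset.filter_add_not (fun w => w = G i) (T i), Multiset.map_add,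
        Multiset.sum_add, hfilter, Multiset.map_replicate, Multiset.sum_replicate,
        ← Nat.cast_smul_eq_nsmul ℚ] at hb
      have hrest : (((T i).filter fun w => ¬ w = G i).map M).sum ∈ N := by
        refine multiset_sum_mem _ fun x hx => ?_
        obtain ⟨w, hw, rfl⟩ := Multiset.mem_map.mp hx
        obtain ⟨hw, hne⟩ := Multiset.mem_filter.mp hw
        obtain ⟨j, rfl⟩ := hrange i w hw
        have hlt : key (G j) < key (G i) := lt_of_le_of_ne (hle i _ hw) fun h => hne (hkey h)
        have hwj := hwt i _ hw
        refine ih j (lt_of_lt_of_le (Set.ncard_lt_ncard ?_ (hlow i)) (Nat.lt_succ_iff.mp hk))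
        refine ⟨fun v hv => ⟨hv.1.trans hwj, hv.2.trans hlt⟩, fun hsub => ?_⟩
        exact lt_irrefl _ (hsub (show G j ∈ _ from ⟨hwj, hlt⟩)).2
      have h1 := (Submodule.add_mem_iff_left _ hrest).mp hb
      refine (Submodule.smul_mem_iff _ ?_).mp h1
      rw [Nat.cast_ne_zero, Multiset.count_ne_zero]
      exact hmem i

end Triangular

/-! ### The two algebras, their bases and their isomorphism -/

theorem prod_map_monomialQSym (L : List (List ℕ+)) :
    (L.map monomialQSym).prod = ((stuffleProd L).map monomialQSym).sum := by
  induction L with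
  | nil => simp [stuffleProd, monomialQSym_nil]
  | cons l L ih =>
    rw [List.map_cons, List.prod_cons, ih, stuffleProd, Multiset.map_bind, Multiset.sum_bind,
      ← Multiset.sum_map_mul_left]
    refine congrArg _ (Multiset.map_congr rfl fun v _ => ?_)
    rw [monomialQSym_mul]

/-- A linear span which contains `1` and the products of its generators is the algebra they
generate. -/
theorem toSubmodule_adjoin_eq_span {A ι : Type*} [CommRing A] [Algebra ℚ A] {b : ι → A}
    (h1 : 1 ∈ Submodule.span ℚ (Set.range b))
    (hmul : ∀ i j, b i * b j ∈ Submodule.span ℚ (Set.range b)) :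
    Subalgebra.toSubmodule (Algebra.adjoin ℚ (Set.range b)) =
      Submodule.span ℚ (Set.range b) := by
  apply le_antisymm
  · have hmul' : ∀ x y, x ∈ Submodule.span ℚ (Set.range b) →
        y ∈ Submodule.span ℚ (Set.range b) → x * y ∈ Submodule.span ℚ (Set.range b) := by
      intro x y hx hy
      have h := Submodule.mul_mem_mul hx hy
      rw [Submodule.span_mul_span] at h
      refine Submodule.span_le.mpr ?_ h
      rintro - ⟨-, ⟨i, rfl⟩, -, ⟨j, rfl⟩, rfl⟩
      exact hmul i j
    exact Algebra.adjoin_le (S := (Submodule.span ℚ (Set.range b)).toSubalgebra h1 hmul')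
      Submodule.subset_span
  · exact Submodule.span_le.mpr Algebra.subset_adjoin

theorem sum_map_stuffle_mem_span {A : Type*} [AddCommGroup A] [Module ℚ A] (b : List ℕ+ → A)
    (I J : ConvIndex) : ((stuffle I.1 J.1).map b).sum ∈
      Submodule.span ℚ (Set.range fun K : ConvIndex => b K.1) := by
  refine multiset_sum_mem _ fun x hx => ?_
  obtain ⟨w, hw, rfl⟩ := Multiset.mem_map.mp hx
  exact Submodule.subset_span ⟨⟨w, head_mem_stuffle I.2 J.2 hw⟩, rfl⟩

theorem toSubmodule_QSymCv : Subalgebra.toSubmodule QSymCv =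
    Submodule.span ℚ (Set.range fun I : ConvIndex => monomialQSym I.1) := by
  refine toSubmodule_adjoin_eq_span ?_ fun I J => ?_
  · exact Submodule.subset_span ⟨⟨[], by simp⟩, monomialQSym_nil⟩
  · rw [monomialQSym_mul]
    exact sum_map_stuffle_mem_span _ I J

theorem toSubmodule_HmzfCv : Subalgebra.toSubmodule HmzfCv =
    Submodule.span ℚ (Set.range fun s : ConvIndex => hurwitzMultizeta s.1) := by
  refine toSubmodule_adjoin_eq_span ?_ fun I J => ?_
  · exact Submodule.subset_span ⟨⟨[], by simp⟩, hurwitzMultizeta_nil⟩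
  · rw [hurwitzMultizeta_mul I.2 J.2]
    exact sum_map_stuffle_mem_span _ I J

/-- The Hurwitz multizeta function of a convergent index, in the algebra they generate. -/
noncomputable def hurwitzMultizetaCv (I : ConvIndex) : HmzfCv :=
  ⟨hurwitzMultizeta I.1, Algebra.subset_adjoin ⟨I, rfl⟩⟩

section Basis

variable {A ι : Type*} [CommRing A] [Algebra ℚ A] {S : Subalgebra ℚ A} {b : ι → S}

theorem linearIndependent_of_coe (h : LinearIndependent ℚ fun i => (b i : A)) :
    LinearIndependent ℚ b :=
  LinearIndependent.of_comp S.val.toLinearMap h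

theorem span_eq_top_of_coe
    (h : Subalgebra.toSubmodule S = Submodule.span ℚ (Set.range fun i => (b i : A))) :
    Submodule.span ℚ (Set.range b) = ⊤ := by
  apply Submodule.map_injective_of_injective (f := S.val.toLinearMap) Subtype.val_injective
  rw [Submodule.map_span, ← Set.range_comp, Submodule.map_top]
  refine h.symm.trans ?_
  ext x
  simp

end Basis

theorem linearIndependent_monomialQSymCv : LinearIndependent ℚ monomialQSymCv := by
  have h : LinearIndependent ℚ fun I : ConvIndex => monomialQSym I.1 :=
    linearIndependent_monomialQSym.comp Subtype.val Subtype.val_injective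
  exact linearIndependent_of_coe (S := QSymCv) (b := monomialQSymCv) h

theorem span_monomialQSymCv : Submodule.span ℚ (Set.range monomialQSymCv) = ⊤ :=
  span_eq_top_of_coe (S := QSymCv) (b := monomialQSymCv) toSubmodule_QSymCv

theorem linearIndependent_hurwitzMultizetaCv : LinearIndependent ℚ hurwitzMultizetaCv :=
  linearIndependent_of_coe (S := HmzfCv) (b := hurwitzMultizetaCv)
    linearIndependent_hurwitzMultizeta

theorem span_hurwitzMultizetaCv : Submodule.span ℚ (Set.range hurwitzMultizetaCv) = ⊤ :=
  span_eq_top_of_coe (S := HmzfCv) (b := hurwitzMultizetaCv) toSubmodule_HmzfCv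

/-- The basis of the `M_I`. -/
noncomputable def basisQSymCv : Module.Basis ConvIndex ℚ QSymCv :=
  Module.Basis.mk linearIndependent_monomialQSymCv span_monomialQSymCv.ge

/-- The basis of the Hurwitz multizeta functions. -/
noncomputable def basisHmzfCv : Module.Basis ConvIndex ℚ HmzfCv :=
  Module.Basis.mk linearIndependent_hurwitzMultizetaCv span_hurwitzMultizetaCv.ge

theorem basisQSymCv_apply (I : ConvIndex) : basisQSymCv I = monomialQSymCv I :=
  Module.Basis.mk_apply _ _ I

theorem basisHmzfCv_apply (I : ConvIndex) : basisHmzfCv I = hurwitzMultizetaCv I :=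
  Module.Basis.mk_apply _ _ I

/-- The words of a quasi-shuffle product of convergent indices, as convergent indices. -/
def convStuffle (I J : ConvIndex) : Multiset ConvIndex :=
  (stuffle I.1 J.1).pmap Subtype.mk fun _ hw => head_mem_stuffle I.2 J.2 hw

theorem map_convStuffle {β : Type*} (f : List ℕ+ → β) (I J : ConvIndex) :
    (convStuffle I J).map (fun K => f K.1) = (stuffle I.1 J.1).map f := by
  rw [convStuffle, Multiset.map_pmap, Multiset.pmap_eq_map]

theorem monomialQSymCv_mul (I J : ConvIndex) :
    monomialQSymCv I * monomialQSymCv J = ((convStuffle I J).map monomialQSymCv).sum := by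
  apply Subtype.ext
  change monomialQSym I.1 * monomialQSym J.1 =
    QSymCv.val ((convStuffle I J).map monomialQSymCv).sum
  rw [monomialQSym_mul, map_multiset_sum, Multiset.map_map, ← map_convStuffle]
  rfl

theorem hurwitzMultizetaCv_mul (I J : ConvIndex) :
    hurwitzMultizetaCv I * hurwitzMultizetaCv J =
      ((convStuffle I J).map hurwitzMultizetaCv).sum := by
  apply Subtype.ext
  change hurwitzMultizeta I.1 * hurwitzMultizeta J.1 =
    HmzfCv.val ((convStuffle I J).map hurwitzMultizetaCv).sum
  rw [hurwitzMultizeta_mul I.2 J.2, map_multiset_sum, Multiset.map_map, ← map_convStuffle]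
  rfl

/-- The linear isomorphism exchanging `M_I` and the Hurwitz multizeta function of `I`. -/
noncomputable def linearEquivQSymCvHmzfCv : QSymCv ≃ₗ[ℚ] HmzfCv :=
  basisQSymCv.equiv basisHmzfCv (Equiv.refl _)

theorem linearEquivQSymCvHmzfCv_apply (I : ConvIndex) :
    linearEquivQSymCvHmzfCv (monomialQSymCv I) = hurwitzMultizetaCv I := by
  rw [← basisQSymCv_apply, ← basisHmzfCv_apply, linearEquivQSymCvHmzfCv, Module.Basis.equiv_apply,
    Equiv.refl_apply]

/-- Both sides are bilinear, and on basis elements both structure constants are the multiplicities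
in `convStuffle`. -/
theorem linearEquivQSymCvHmzfCv_mul (x y : QSymCv) :
    linearEquivQSymCvHmzfCv (x * y) = linearEquivQSymCvHmzfCv x * linearEquivQSymCvHmzfCv y := by
  have h : (LinearMap.mul ℚ QSymCv).compr₂ linearEquivQSymCvHmzfCv.toLinearMap =
      (LinearMap.mul ℚ HmzfCv).compl₁₂ linearEquivQSymCvHmzfCv.toLinearMap
        linearEquivQSymCvHmzfCv.toLinearMap := by
    refine basisQSymCv.ext fun I => basisQSymCv.ext fun J => ?_
    simp only [LinearMap.compr₂_apply, LinearMap.compl₁₂_apply, LinearMap.mul_apply',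
      LinearEquiv.coe_coe, basisQSymCv_apply, linearEquivQSymCvHmzfCv_apply]
    rw [monomialQSymCv_mul, hurwitzMultizetaCv_mul, map_multiset_sum, Multiset.map_map]
    exact congrArg _ (Multiset.map_congr rfl fun K _ => linearEquivQSymCvHmzfCv_apply K)
  exact LinearMap.congr_fun₂ h x y

theorem linearEquivQSymCvHmzfCv_one : linearEquivQSymCvHmzfCv 1 = 1 := by
  have h1 : (1 : QSymCv) = monomialQSymCv ⟨[], by simp⟩ :=
    Subtype.ext monomialQSym_nil.symm
  rw [h1, linearEquivQSymCvHmzfCv_apply]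
  exact Subtype.ext hurwitzMultizeta_nil

/-- The algebra isomorphism exchanging `M_I` and the Hurwitz multizeta function of `I`. -/
noncomputable def algEquivQSymCvHmzfCv : QSymCv ≃ₐ[ℚ] HmzfCv :=
  AlgEquiv.ofLinearEquiv linearEquivQSymCvHmzfCv linearEquivQSymCvHmzfCv_one
    linearEquivQSymCvHmzfCv_mul

/-! ### Polynomial generators -/

/-- The Lyndon words other than `y₁`, for the order `y₁ > y₂ > ⋯`. -/
abbrev RevLyndonWord : Type := LyndonWordNeOne fun a b : ℕ+ => b < a

/-- The multiset of Lyndon words of a monomial. -/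
noncomputable def lyndonFactors (m : RevLyndonWord →₀ ℕ) : Multiset (List ℕ+) :=
  (Finsupp.toMultiset m).map Subtype.val

theorem mem_lyndonFactors {m : RevLyndonWord →₀ ℕ} {w : List ℕ+} (hw : w ∈ lyndonFactors m) :
    IsRevLyndon w ∧ w ≠ [1] := by
  obtain ⟨l, -, rfl⟩ := Multiset.mem_map.mp hw
  exact l.2

theorem flatten_revSort_lyndonFactors_injective :
    Function.Injective fun m => (revSort (lyndonFactors m)).flatten := by
  intro m m' h
  have h1 := flatten_revSort_inj (fun w hw => (mem_lyndonFactors hw).1)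
    (fun w hw => (mem_lyndonFactors hw).1) h
  classical
  exact Function.LeftInverse.injective (g := Multiset.toFinsupp) Finsupp.toMultiset_toFinsupp
    (Multiset.map_injective Subtype.val_injective h1)

theorem mem_stuffleProd_lyndonFactors_head {m : RevLyndonWord →₀ ℕ} {w : List ℕ+}
    (hw : w ∈ stuffleProd (revSort (lyndonFactors m))) : ∀ a ∈ w.head?, 2 ≤ a := by
  refine forall_mem_stuffleProd_head (fun l hl => ?_) hw
  have := mem_lyndonFactors (m := m) (w := l) (by rwa [← coe_revSort (lyndonFactors m)])
  exact this.1.two_le_head this.2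

theorem range_flatten_revSort_lyndonFactors :
    (Set.range fun m => (revSort (lyndonFactors m)).flatten) =
      {w : List ℕ+ | ∀ a ∈ w.head?, 2 ≤ a} := by
  ext w
  constructor
  · rintro ⟨m, rfl⟩
    exact mem_stuffleProd_lyndonFactors_head (flatten_mem_stuffleProd _)
  · intro hw
    obtain ⟨S, hS, rfl⟩ := exists_flatten_revSort_eq hw
    lift S to Multiset RevLyndonWord using hS
    refine ⟨Multiset.toFinsupp S, ?_⟩
    simp [lyndonFactors]

/-- `M_w`, for a Lyndon word `w`, as an element of `QSymCv`. -/
noncomputable def lyndonQSymCv (w : RevLyndonWord) : QSymCv :=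
  monomialQSymCv ⟨w.1, w.2.1.two_le_head w.2.2⟩

theorem aeval_lyndonQSymCv_monomial (m : RevLyndonWord →₀ ℕ) :
    ((MvPolynomial.aeval lyndonQSymCv (MvPolynomial.monomial m (1 : ℚ)) : QSymCv) : QSym) =
      ((stuffleProd (revSort (lyndonFactors m))).map monomialQSym).sum := by
  rw [← prod_map_monomialQSym, ← Multiset.prod_coe, ← Multiset.map_coe, coe_revSort,
    lyndonFactors, Multiset.map_map, MvPolynomial.aeval_monomial, map_one, one_mul]
  change QSymCv.val _ = _
  rw [map_finsuppProd, Finsupp.toMultiset_map, Finsupp.prod_toMultiset,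
    Finsupp.prod_mapDomain_index (fun _ => pow_zero _) (fun _ _ _ => pow_add _ _ _)]
  exact Finsupp.prod_congr fun _ _ => map_pow _ _ _

theorem linearIndependent_stuffleProd : LinearIndependent ℚ fun m : RevLyndonWord →₀ ℕ =>
    ((stuffleProd (revSort (lyndonFactors m))).map monomialQSym).sum :=
  linearIndependent_of_triangular revKey_injective linearIndependent_monomialQSym
    flatten_revSort_lyndonFactors_injective (fun _ => flatten_mem_stuffleProd _)
    fun _ _ hw => revKey_le_of_mem_stuffleProd (fun _ hl => (mem_lyndonFactors hl).1) hw

theorem span_stuffleProd : Submodule.span ℚ (Set.range fun m : RevLyndonWord →₀ ℕ =>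
    ((stuffleProd (revSort (lyndonFactors m))).map monomialQSym).sum) =
      Subalgebra.toSubmodule QSymCv := by
  rw [span_eq_of_triangular (M := monomialQSym) (wt := wordWeight) revKey_injective
    (G := fun m => (revSort (lyndonFactors m)).flatten) (fun _ => flatten_mem_stuffleProd _)
    (fun _ _ hw => revKey_le_of_mem_stuffleProd (fun _ hl => (mem_lyndonFactors hl).1) hw)
    (fun _ _ hw => ?_) (fun _ _ hw => wordWeight_of_mem_stuffleProd hw)
    finite_setOf_wordWeight_eq, range_flatten_revSort_lyndonFactors, toSubmodule_QSymCv]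
  · congr 1
    ext x
    simp
  · rw [range_flatten_revSort_lyndonFactors]
    exact mem_stuffleProd_lyndonFactors_head hw

/-- Evaluation sends the basis of monomials to the triangular family of quasi-shuffle products,
which is again a basis. -/
theorem bijective_aeval_lyndonQSymCv : Function.Bijective
    (MvPolynomial.aeval lyndonQSymCv : MvPolynomial RevLyndonWord ℚ →ₐ[ℚ] QSymCv) := by
  set f := (MvPolynomial.aeval lyndonQSymCv : MvPolynomial RevLyndonWord ℚ →ₐ[ℚ] QSymCv)
  set b := MvPolynomial.basisMonomials RevLyndonWord ℚ
  have hval : (fun m => ((f (b m) : QSymCv) : QSym)) = fun m =>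
      ((stuffleProd (revSort (lyndonFactors m))).map monomialQSym).sum := by
    funext m
    rw [show b m = MvPolynomial.monomial m 1 by simp [b]]
    exact aeval_lyndonQSymCv_monomial m
  have hli : LinearIndependent ℚ fun m => f (b m) := by
    apply linearIndependent_of_coe
    rw [hval]
    exact linearIndependent_stuffleProd
  have hspan : Submodule.span ℚ (Set.range fun m => f (b m)) = ⊤ := by
    apply span_eq_top_of_coe
    rw [hval]
    exact span_stuffleProd.symm
  set e := b.equiv (Module.Basis.mk hli hspan.ge) (Equiv.refl _)
  have he : f.toLinearMap = e.toLinearMap := by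
    refine b.ext fun m => ?_
    simp [e]
  have : (f : MvPolynomial RevLyndonWord ℚ → QSymCv) = e := by
    funext x
    exact LinearMap.congr_fun he x
  rw [this]
  exact e.bijective

theorem isLyndon_singleton (lt : ℕ+ → ℕ+ → Prop) (a : ℕ+) : IsLyndon lt [a] := by
  refine ⟨by simp, fun u v hu hv h => ?_⟩
  have := congrArg List.length h
  rw [List.length_append, List.length_singleton] at this
  have := List.length_pos_iff.mpr hu
  have := List.length_pos_iff.mpr hv
  omega

theorem infinite_lyndonWordNeOne (lt : ℕ+ → ℕ+ → Prop) : Infinite (LyndonWordNeOne lt) := by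
  refine Infinite.of_injective (fun n : ℕ+ => (⟨[n + 1], isLyndon_singleton lt _, ?_⟩ :
    LyndonWordNeOne lt)) fun m n h => ?_
  · intro h
    exact (PNat.lt_add_left 1 n).ne' (List.singleton_injective h)
  · exact add_right_cancel (List.singleton_injective (congrArg Subtype.val h))

/-- A polynomial algebra depends only on the cardinality of its set of indeterminates. Both sets are
countable, and infinite because of the letters `y₂, y₃, …`, so the result for one order gives the
others. -/
theorem nonempty_lyndonWordNeOne_equiv (lt lt' : ℕ+ → ℕ+ → Prop) :
    Nonempty (LyndonWordNeOne lt ≃ LyndonWordNeOne lt') := by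
  have := infinite_lyndonWordNeOne lt
  have := infinite_lyndonWordNeOne lt'
  exact nonempty_equiv_of_countable

theorem corollary1 :
    -- the generating families span these algebras linearly
    Subalgebra.toSubmodule HmzfCv =
      Submodule.span ℚ (Set.range fun s : ConvIndex => hurwitzMultizeta s.1) ∧
    Subalgebra.toSubmodule QSymCv =
      Submodule.span ℚ (Set.range fun I : ConvIndex => monomialQSym I.1) ∧
    -- the two algebras are isomorphic, `M_I` corresponding to the Hurwitz multizeta function of `I`
    (∃ Φ : QSymCv ≃ₐ[ℚ] HmzfCv, ∀ I : ConvIndex,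
      (Φ (monomialQSymCv I) : HurwitzDomain → ℂ) = hurwitzMultizeta I.1) ∧
    -- both are polynomial algebras on the Lyndon words other than `y₁`, for any order on the letters
    (∀ lt : ℕ+ → ℕ+ → Prop, IsStrictTotalOrder ℕ+ lt →
      Nonempty (QSymCv ≃ₐ[ℚ] MvPolynomial (LyndonWordNeOne lt) ℚ) ∧
      Nonempty (HmzfCv ≃ₐ[ℚ] MvPolynomial (LyndonWordNeOne lt) ℚ)) ∧
    -- and for `y₁ > y₂ > ⋯` the Lyndon words themselves, read as `M_w`, are free generators
    (∃ Ψ : MvPolynomial (LyndonWordNeOne fun a b : ℕ+ => b < a) ℚ ≃ₐ[ℚ] QSymCv,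
      ∀ w : LyndonWordNeOne fun a b : ℕ+ => b < a,
        ((Ψ (MvPolynomial.X w) : QSymCv) : QSym) = monomialQSym w.1) := by

  set Ψ := AlgEquiv.ofBijective _ bijective_aeval_lyndonQSymCv
  refine ⟨toSubmodule_HmzfCv, toSubmodule_QSymCv, ⟨algEquivQSymCvHmzfCv, fun I => ?_⟩,
    fun lt _ => ?_, ⟨Ψ, fun w => ?_⟩⟩
  · exact congrArg Subtype.val (linearEquivQSymCvHmzfCv_apply I)
  · obtain ⟨e⟩ := nonempty_lyndonWordNeOne_equiv (fun a b : ℕ+ => b < a) lt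
    have Θ : QSymCv ≃ₐ[ℚ] MvPolynomial (LyndonWordNeOne lt) ℚ :=
      Ψ.symm.trans (MvPolynomial.renameEquiv ℚ e)
    exact ⟨⟨Θ⟩, ⟨algEquivQSymCvHmzfCv.symm.trans Θ⟩⟩
  · have h : Ψ (MvPolynomial.X w) = lyndonQSymCv w := MvPolynomial.aeval_X _ _
    rw [h]
    rfl
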